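/- **Theorem 3.2.** Let $D=\{z\in\mathbb R^2:|z|<1\}$ and $S^1=\partial D$, where $S^1$ is identified with $\mathbb R/\mathbb Z$ by $t\mapsto(\cos 2\pi t,\sin 2\pi t)$. Let $d'$ be the hyperbolic distance of the Beltrami–Klein model on $D$, that is $$d'(P,Q)=d(G^{-1}(P),G^{-1}(Q)),\quad G^{-1}(z)=\frac{z}{1+\sqrt{1-|z|^2}},\quad d(z,w)=\operatorname{arccosh}\Bigl(1+\frac{2|z-w|^2}{(1-|z|^2)(1-|w|^2)}\Bigr).$$ Let $P,Q,R\in D$ be the vertices of a nondegenerate triangle. Let $T_1,T_2\in S^1$ be the two points in which the line $PQ$ meets $S^1$, labelled so that $T_1-T_2\in(0,\frac12]$ mod $1$. Let $T_3\in S^1$ be the point with $2T_3=T_1+T_2$ mod $1$ and $T_3-T_2\in(0,\frac12]$ mod $1$, and put $T_4=T_3+\frac14$ mod $1$. Let $(x_1,x_2)'$ denote the point $x_1T_3+x_2T_4$ of the plane, let $u$ be the $x_1$-coordinate of $P$, and let $k=e^{d'(P,Q)}$. Put $N=(k^2-2ku+1)(k^2+2ku+1)$ and $$A=\frac{2k(k^2+1)(1-u^2)}{N},\qquad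 B=\frac{(k^2+1)\sqrt{1-u^2}}{\sqrt N},\qquad C=\frac{(k^2-1)^2u}{N},$$ $$E=\Bigl\{(x_1,x_2)'\;:\;\frac{(x_1-C)^2}{A^2}+\frac{x_2^2}{B^2}=1\Bigr\},\qquad \Phi=\Bigl\{(x_1,x_2)'\;:\;\frac{(x_1-C)^2}{A^2}+\frac{x_2^2}{B^2}<1\Bigr\}.$$ 1. $N,A,B>0$, so $E$ is an ellipse, and $\Phi$ is the inner region bounded by it. Moreover, if $u(k^2-1)\neq2k\sqrt{1-u^2}$ and $a=\dfrac{k^2-1}{u(k^2-1)-2k\sqrt{1-u^2}}$, then $M:=(u^2+1)a^2-2au+1>0$, $a^2-2ua+1\ge 0$, and $$A=\frac{|au-1|\sqrt{a^2-2ua+1}}{M},\qquad B=\frac{\sqrt{a^2-2ua+1}}{\sqrt M},\qquad C=\frac{a^2u}{M}.$$ 2. $E\subset D\cup S^1$, and $E$ is tangent to $S^1$ at $T_1$ and at $T_2$ (it passes through each of these points and has the same tangent line there as $S^1$). 3. Let $m$ be the number of triangles with vertices on $S^1$ that circumscribe the triangle $PQR$, i.e. such that $P,Q,R$ lie one on each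 of the three sides. Then $m=0$ if $R\in\Phi$, $m=1$ if $R\in E$, and $m=2$ if $R\notin\operatorname{cl}\Phi$. 4. For $v\in S^1$ let $\psi(v)$ be the first point $w\neq v$ of $S^1$, going counterclockwise from $v$, such that the segment $vw$ is tangent to the triangle $PQR$ (it meets the closed triangle but not its interior). The map $\psi:S^1\to S^1$ has a unique continuous monotone lift $F:\mathbb R\to\mathbb R$ with $F(x+1)=F(x)+1$ and $F(0)\in(0,1)$. Its rotation number $\rho=\lim_{n\to\infty}F^n(0)/n$ equals $\frac13$ if and only if $R\in E$ or $R\notin\operatorname{cl}\Phi$. -/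

import Mathlib

open Set

noncomputable section

namespace BarBilliard

/-- The point `exp (2 π i t)` of the unit circle in the plane `ℝ² = ℂ` given by `t ∈ ℝ/ℤ`. -/
def circlePt (t : UnitAddCircle) : ℂ := (AddCircle.toCircle t : ℂ)

/-- The hyperbolic distance of the Poincaré disk `{‖z‖ < 1}`
with the metric `ds² = 4 |dz|² / (1 - |z|²)²`. -/
def poincareDist (z w : ℂ) : ℝ :=
  Real.arcosh (1 + 2 * ‖z - w‖ ^ 2 / ((1 - ‖z‖ ^ 2) * (1 - ‖w‖ ^ 2)))

/-- The isometry from the Beltrami–Klein disk to the Poincaré disk. -/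
def kleinToPoincare (z : ℂ) : ℂ := (1 / (1 + Real.sqrt (1 - ‖z‖ ^ 2))) • z

/-- The hyperbolic distance of the Beltrami–Klein disk `{‖z‖ < 1}`. -/
def kleinDist (z w : ℂ) : ℝ := poincareDist (kleinToPoincare z) (kleinToPoincare w)

/-- The triangles (as sets of three distinct vertices) that are inscribed in the unit circle and
circumscribe the triangle `PQR`: the points `P`, `Q`, `R` lie one on each of the three sides. -/
def circumscribingTriangles (P Q R : ℂ) : Set (Set ℂ) :=
  {T | ∃ a b c : ℂ, a ≠ b ∧ b ≠ c ∧ c ≠ a ∧ T = {a, b, c} ∧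
    a ∈ Metric.sphere (0 : ℂ) 1 ∧ b ∈ Metric.sphere (0 : ℂ) 1 ∧ c ∈ Metric.sphere (0 : ℂ) 1 ∧
    P ∈ segment ℝ b c ∧ Q ∈ segment ℝ c a ∧ R ∈ segment ℝ a b}

/-- The ellipse `(x₁ - C)² / A² + x₂² / B² = 1`, where `(x₁, x₂)` are the coordinates with respect
to the basis `e₁, e₂` of the plane. -/
def ellipse (e₁ e₂ : ℂ) (A B C : ℝ) : Set ℂ :=
  {z | ∃ x₁ x₂ : ℝ, z = x₁ • e₁ + x₂ • e₂ ∧ (x₁ - C) ^ 2 / A ^ 2 + x₂ ^ 2 / B ^ 2 = 1}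

/-- The (open) inner region bounded by `ellipse e₁ e₂ A B C`. -/
def ellipseInner (e₁ e₂ : ℂ) (A B C : ℝ) : Set ℂ :=
  {z | ∃ x₁ x₂ : ℝ, z = x₁ • e₁ + x₂ • e₂ ∧ (x₁ - C) ^ 2 / A ^ 2 + x₂ ^ 2 / B ^ 2 < 1}

/-- The curves `S` and `S'` are tangent at `z`: both pass through `z`, with the same tangent
line there. -/
def AreTangentAt (S S' : Set ℂ) (z : ℂ) : Prop :=
  z ∈ S ∧ z ∈ S' ∧ tangentConeAt ℝ S z = tangentConeAt ℝ S' z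

/-- The segment between the points `v`, `w` of the unit circle is tangent to the triangle `PQR`:
it touches the triangle without entering its interior. -/
def IsTangentChord (P Q R : ℂ) (v w : UnitAddCircle) : Prop :=
  (segment ℝ (circlePt v) (circlePt w) ∩ convexHull ℝ {P, Q, R}).Nonempty ∧
    Disjoint (segment ℝ (circlePt v) (circlePt w)) (interior (convexHull ℝ {P, Q, R}))

/-- The bar billiard map `ψ` of the triangle `PQR`: it sends `v ∈ S¹ = ℝ/ℤ` to the first point
`w ≠ v` in the counterclockwise direction such that the segment `vw` is tangent to the triangle. -/
def barMap (P Q R : ℂ) (v : UnitAddCircle) : UnitAddCircle :=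
  v + ((sInf {s : ℝ | s ∈ Ioo (0 : ℝ) 1 ∧ IsTangentChord P Q R v (v + (s : UnitAddCircle))} : ℝ) :
    UnitAddCircle)

/-- `F` is the continuous monotone lift to `ℝ`, with `F 0 ∈ (0, 1)`, of the circle map `f`.
The rotation number of `f` is `F.translationNumber = lim Fⁿ(0) / n`. -/
def IsLift (F : CircleDeg1Lift) (f : UnitAddCircle → UnitAddCircle) : Prop :=
  Continuous F ∧ F 0 ∈ Ioo (0 : ℝ) 1 ∧ ∀ x : ℝ, ((F x : ℝ) : UnitAddCircle) = f (x : UnitAddCircle)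

end BarBilliard

end

/-!
A chord of the circle through a point `X` of the disk defines an involution of the circle, the
half-turn about `X` of the Beltrami–Klein model acting at infinity (`otherEnd`). A triangle
inscribed in the circle with `P`, `Q`, `R` on its sides is the same as a fixed point `b` of the
composition of the half-turns about `P`, `Q`, `R`. This composition is a Möbius map with matrix
`!![α, β; -conj β, -conj α]` (`turnA`, `turnB`), so its fixed points on the circle are cut out by
the line `Re (conj β b) = -Re α`. Their number is `0`, `1` or `2` according to the sign of
`|β|² - (Re α)²`, which equals `S² - (1 - |P|²)(1 - |Q|²)(1 - |R|²)` with `S` twice the area of the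
triangle (`normSq_turnB`).

In the frame `T₃, T₄` the points `P`, `Q` lie on the vertical line `x = u`, and `S` is, up to sign,
the product of `x(R) - u` and the length of `PQ`. As a condition on `R` the criterion therefore
compares `x² + y² + κ (x - u)²` with `1`, where `κ = |P - Q|² / ((1 - |P|²)(1 - |Q|²))`. The
formula for `cosh d'(P, Q)` turns `κ` into `sinh² d'(P, Q) / (1 - u²)`, and completing the square
gives the half-axes and the centre of the statement (`ellipse_axes`, `ellipse_equation`). The term
`κ (x - u)²` is nonnegative and vanishes to second order on the line `PQ`, so the ellipse lies in
the disk and is tangent to the circle at the endpoints of that line.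

The involution of `X` lifts to a homeomorphism `chordLift X` of `ℝ` with square `x ↦ x + 1`, and
the bar billiard map lifts to the minimum of the three lifts of the vertices (`barMap_coe`). Its
rotation number is `1 / 3` exactly when `F³ x = x + 1` for some `x`. In such an orbit the three
steps use three different vertices, since two steps with the same vertex already make a full turn;
conversely a fixed point of the composition of the half-turns, traversed counterclockwise, is such
an orbit, because each of its steps is the smallest of the three (`chordLift_le_of_cycle`). Hence
the rotation number is `1 / 3` exactly when a circumscribing triangle exists.
-/

namespace BarBilliard

open ComplexConjugate

/-! ### Chords through a point of the disk -/

/-- The second endpoint of the chord of the unit circle that starts at `z` and passes through the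
point `X` of the open disk. As a map of `z` it is the half-turn about `X` of the Beltrami–Klein
model, acting on the circle at infinity. -/
noncomputable def otherEnd (X z : ℂ) : ℂ := (z - X) / (conj X * z - 1)

lemma mul_conj_of_norm_eq_one {z : ℂ} (hz : ‖z‖ = 1) : z * conj z = 1 := by
  rw [Complex.mul_conj, Complex.normSq_eq_norm_sq, hz]; simp

lemma conj_mul_sub_one_ne_zero {X z : ℂ} (hX : ‖X‖ < 1) (hz : ‖z‖ = 1) :
    conj X * z - 1 ≠ 0 := by
  intro h
  have h1 : ‖conj X * z‖ = 1 := by rw [sub_eq_zero.1 h]; simp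
  rw [norm_mul, hz, RCLike.norm_conj, mul_one] at h1
  exact hX.ne h1

lemma eq_otherEnd_iff {X z w : ℂ} (hX : ‖X‖ < 1) (hz : ‖z‖ = 1) :
    w = otherEnd X z ↔ w * (conj X * z - 1) = z - X :=
  eq_div_iff (conj_mul_sub_one_ne_zero hX hz)

lemma norm_otherEnd {X z : ℂ} (hX : ‖X‖ < 1) (hz : ‖z‖ = 1) : ‖otherEnd X z‖ = 1 := by
  have h : z - X = -z * conj (conj X * z - 1) := by
    simp only [map_sub, map_mul, Complex.conj_conj, map_one]
    linear_combination X * mul_conj_of_norm_eq_one hz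
  rw [otherEnd, h, norm_div, norm_mul, norm_neg, hz, RCLike.norm_conj, one_mul]
  exact div_self (norm_ne_zero_iff.2 (conj_mul_sub_one_ne_zero hX hz))

lemma otherEnd_otherEnd {X z : ℂ} (hX : ‖X‖ < 1) (hz : ‖z‖ = 1) :
    otherEnd X (otherEnd X z) = z := by
  have h := (eq_otherEnd_iff hX hz).1 rfl
  refine ((eq_otherEnd_iff hX (norm_otherEnd hX hz)).2 ?_).symm
  linear_combination h

lemma otherEnd_ne {X z : ℂ} (hX : ‖X‖ < 1) (hz : ‖z‖ = 1) : otherEnd X z ≠ z := by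
  intro h
  have h1 := (eq_otherEnd_iff hX hz).1 h.symm
  have h2 : 2 = X * conj z + conj X * z := by
    linear_combination (-conj z) * h1 + (conj X * z - 2) * mul_conj_of_norm_eq_one hz
  have h3 : ‖X * conj z + conj X * z‖ < 2 := by
    refine (norm_add_le _ _).trans_lt ?_
    simp only [norm_mul, RCLike.norm_conj, hz, mul_one]
    linarith
  rw [← h2] at h3
  simp at h3

/-- A point of the open disk lies on a chord exactly when the involution of the point exchanges the
endpoints of the chord. -/
lemma mem_segment_iff_eq_otherEnd {X b c : ℂ} (hX : ‖X‖ < 1) (hb : ‖b‖ = 1) (hc : ‖c‖ = 1) :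
    X ∈ segment ℝ b c ↔ c = otherEnd X b := by
  have eb := mul_conj_of_norm_eq_one hb
  have ec := mul_conj_of_norm_eq_one hc
  rw [eq_otherEnd_iff hX hb]
  constructor
  · rintro ⟨s, t, -, -, hst, rfl⟩
    have hst' : (s : ℂ) + t = 1 := mod_cast hst
    simp only [Complex.real_smul, map_add, map_mul, Complex.conj_ofReal]
    linear_combination (c * s) * eb + (t * b) * ec + (b + c) * hst'
  · intro h
    have hne : c - b ≠ 0 := by
      intro h0
      rw [sub_eq_zero] at h0
      exact otherEnd_ne hX hb (((eq_otherEnd_iff hX hb).2 h).symm.trans h0)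
    have hne' : conj c - conj b ≠ 0 := by
      rw [← map_sub]; exact (map_ne_zero _).2 hne
    -- the ratio `(X - b) / (c - b)` is real because the chord equation says it equals its conjugate
    have hreal : conj ((X - b) / (c - b)) = (X - b) / (c - b) := by
      rw [map_div₀, map_sub, map_sub, div_eq_div_iff hne' hne]
      linear_combination -(conj c - conj b) * h + (conj X * b - 1) * ec + (1 - conj X * c) * eb
    obtain ⟨t, ht⟩ := Complex.conj_eq_iff_real.1 hreal
    rw [div_eq_iff hne] at ht
    have hXt : X = b + t * (c - b) := by linear_combination ht
    have key : 1 - ‖X‖ ^ 2 = t * (1 - t) * ‖c - b‖ ^ 2 := by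
      have e1 : ((‖X‖ ^ 2 : ℝ) : ℂ) = X * conj X := by
        rw [Complex.mul_conj, Complex.normSq_eq_norm_sq]
      have e2 : ((‖c - b‖ ^ 2 : ℝ) : ℂ) = (c - b) * conj (c - b) := by
        rw [Complex.mul_conj, Complex.normSq_eq_norm_sq]
      have : ((1 - ‖X‖ ^ 2 : ℝ) : ℂ) = ((t * (1 - t) * ‖c - b‖ ^ 2 : ℝ) : ℂ) := by
        rw [Complex.ofReal_sub, Complex.ofReal_mul, e1, e2, hXt]
        simp only [map_add, map_mul, map_sub, Complex.conj_ofReal]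
        push_cast
        linear_combination (t - 1) * eb - t * ec
      exact mod_cast this
    have hpos : 0 < t * (1 - t) := by
      have h1 : 0 < t * (1 - t) * ‖c - b‖ ^ 2 := by
        rw [← key]; nlinarith [norm_nonneg X]
      exact pos_of_mul_pos_left h1 (by positivity)
    refine ⟨1 - t, t, by nlinarith, by nlinarith, by ring, ?_⟩
    rw [hXt]
    simp only [Complex.real_smul]
    push_cast
    ring

/-! ### Counting circumscribing triangles -/

/-- First coefficient of the matrix `!![α, β; -conj β, -conj α]` that induces the composition of the
half-turns about `P`, `Q`, `R`. Its imaginary part is minus twice the signed area of the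
triangle. -/
def turnA (P Q R : ℂ) : ℂ := 1 - Q * conj P - R * conj Q + R * conj P

/-- Second coefficient of the matrix `!![α, β; -conj β, -conj α]` that induces the composition of
the half-turns about `P`, `Q`, `R`. -/
def turnB (P Q R : ℂ) : ℂ := Q - P - R * (1 - conj Q * P)

lemma otherEnd_comp_eq_self_iff {P Q R b : ℂ} (hP : ‖P‖ < 1) (hQ : ‖Q‖ < 1) (hR : ‖R‖ < 1)
    (hb : ‖b‖ = 1) :
    otherEnd R (otherEnd Q (otherEnd P b)) = b ↔
      (conj (turnB P Q R) * b).re = -(turnA P Q R).re := by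
  have eb := mul_conj_of_norm_eq_one hb
  have hb0 : b ≠ 0 := norm_ne_zero_iff.1 (by rw [hb]; exact one_ne_zero)
  set c := otherEnd P b with hc
  have nc : ‖c‖ = 1 := norm_otherEnd hP hb
  set a := otherEnd Q c with ha
  have na : ‖a‖ = 1 := norm_otherEnd hQ nc
  have dc := conj_mul_sub_one_ne_zero hP hb
  have da := conj_mul_sub_one_ne_zero hQ nc
  rw [eq_otherEnd_iff hP hb] at hc
  rw [eq_otherEnd_iff hQ nc] at ha
  -- `a` is the image of `b` under the product of two of the matrices
  have ha' : a * ((conj Q - conj P) * b + (1 - conj Q * P)) = (1 - Q * conj P) * b + (Q - P) := by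
    linear_combination (conj P * b - 1) * ha + (1 - a * conj Q) * hc
  have hd : (conj Q - conj P) * b + (1 - conj Q * P) ≠ 0 := by
    have : (conj Q - conj P) * b + (1 - conj Q * P) = (conj Q * c - 1) * (conj P * b - 1) := by
      linear_combination -conj Q * hc
    rw [this]; exact mul_ne_zero da dc
  rw [eq_comm, eq_otherEnd_iff hR na]
  have step : b * (conj R * a - 1) = a - R ↔
      conj (turnB P Q R) * b + conj (conj (turnB P Q R) * b) + (turnA P Q R + conj (turnA P Q R))
        = 0 := by
    have id1 : (b * (conj R * a - 1) - (a - R)) * ((conj Q - conj P) * b + (1 - conj Q * P)) =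
        -b * (conj (turnB P Q R) * b + conj (conj (turnB P Q R) * b)
          + (turnA P Q R + conj (turnA P Q R))) := by
      simp only [turnA, turnB, map_add, map_sub, map_mul, map_one, Complex.conj_conj]
      linear_combination (b * conj R - 1) * ha' + (Q - P - R * (1 - conj Q * P)) * eb
    constructor
    · intro h
      rw [sub_eq_zero.2 h, zero_mul] at id1
      exact (mul_eq_zero.1 id1.symm).resolve_left (neg_ne_zero.2 hb0)
    · intro h
      rw [h, mul_zero] at id1
      exact sub_eq_zero.1 ((mul_eq_zero.1 id1).resolve_right hd)
  rw [step, Complex.add_conj, Complex.add_conj, ← Complex.ofReal_add, Complex.ofReal_eq_zero]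
  constructor <;> intro h <;> linarith

/-- The determinant identity `|α|² - |β|² = ∏ (1 - |X|²)`, with `|α|²` split into real and imaginary
part. -/
lemma normSq_turnB (P Q R : ℂ) :
    ‖turnB P Q R‖ ^ 2 - (turnA P Q R).re ^ 2 =
      (turnA P Q R).im ^ 2 - (1 - ‖P‖ ^ 2) * (1 - ‖Q‖ ^ 2) * (1 - ‖R‖ ^ 2) := by
  simp only [Complex.sq_norm, Complex.normSq_apply, turnA, turnB, Complex.sub_re, Complex.sub_im,
    Complex.add_re, Complex.add_im, Complex.mul_re, Complex.mul_im, Complex.conj_re,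
    Complex.conj_im, Complex.one_re, Complex.one_im]
  ring

/-- A composition of half-turns about three points is not the identity. -/
lemma turnB_ne_zero {P Q R : ℂ} (hP : ‖P‖ < 1) (hQ : ‖Q‖ < 1)
    (h : (turnA P Q R).re ^ 2 ≤ ‖turnB P Q R‖ ^ 2) : turnB P Q R ≠ 0 := by
  intro hB
  have hA : (turnA P Q R).re = 0 := by
    rw [hB, norm_zero] at h
    have : (turnA P Q R).re ^ 2 ≤ 0 := by simpa using h
    exact pow_eq_zero_iff two_ne_zero |>.1 (le_antisymm this (sq_nonneg _))
  have pP : 0 < 1 - ‖P‖ ^ 2 := by nlinarith [norm_nonneg P]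
  have pQ : 0 < 1 - ‖Q‖ ^ 2 := by nlinarith [norm_nonneg Q]
  -- `α (1 - conj Q P)` is real and positive when `β = 0`, so `α` has the direction of `1 - Q conj P`
  have h1 : turnA P Q R * (1 - conj Q * P) = ((1 - ‖P‖ ^ 2) * (1 - ‖Q‖ ^ 2) : ℝ) := by
    have e1 : ((‖P‖ ^ 2 : ℝ) : ℂ) = P * conj P := by
      rw [Complex.mul_conj, Complex.normSq_eq_norm_sq]
    have e2 : ((‖Q‖ ^ 2 : ℝ) : ℂ) = Q * conj Q := by
      rw [Complex.mul_conj, Complex.normSq_eq_norm_sq]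
    rw [Complex.ofReal_mul, Complex.ofReal_sub, Complex.ofReal_sub, e1, e2, Complex.ofReal_one]
    rw [turnB] at hB
    rw [turnA]
    linear_combination (conj Q - conj P) * hB
  have hre : 0 < (1 - conj Q * P).re := by
    have h2 : ‖conj Q * P‖ < 1 := by
      rw [norm_mul, RCLike.norm_conj]
      nlinarith [norm_nonneg P, norm_nonneg Q]
    have := Complex.re_le_norm (conj Q * P)
    simp only [Complex.sub_re, Complex.one_re]
    linarith
  have h3 := congrArg Complex.re h1
  have h4 := congrArg Complex.im h1
  rw [Complex.mul_re, hA, Complex.ofReal_re] at h3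
  rw [Complex.mul_im, hA, Complex.ofReal_im] at h4
  have h5 : (turnA P Q R).im = 0 := by
    rcases mul_eq_zero.1 (by linarith : (turnA P Q R).im * (1 - conj Q * P).re = 0) with h | h
    · exact h
    · exact absurd h hre.ne'
  rw [h5] at h3
  nlinarith [mul_pos pP pQ]

/-- The points `b` of the unit circle with `Re (conj β b) = -s`; a line cuts the circle in them
when `β ≠ 0`. -/
def lineCircle (β : ℂ) (s : ℝ) : Set ℂ := {b | ‖b‖ = 1 ∧ (conj β * b).re = -s}

lemma lineCircle_eq_empty {β : ℂ} {s : ℝ} (h : ‖β‖ ^ 2 < s ^ 2) : lineCircle β s = ∅ := by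
  refine eq_empty_of_forall_notMem ?_
  rintro b ⟨hb, hs⟩
  have h1 := Complex.abs_re_le_norm (conj β * b)
  rw [norm_mul, RCLike.norm_conj, hb, mul_one, hs, abs_neg] at h1
  have := abs_le_of_sq_le_sq' h.le
  exact absurd (sq_le_sq' (by linarith [neg_abs_le s, norm_nonneg β, abs_nonneg s]) h1)
    (by rw [sq_abs]; exact not_le.2 h)

lemma lineCircle_eq_pair {β : ℂ} {s : ℝ} (hβ : β ≠ 0) (h : s ^ 2 ≤ ‖β‖ ^ 2) :
    lineCircle β s = {(⟨-s, √(‖β‖ ^ 2 - s ^ 2)⟩ : ℂ) / conj β,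
      (⟨-s, -√(‖β‖ ^ 2 - s ^ 2)⟩ : ℂ) / conj β} := by
  have hc : conj β ≠ 0 := by simpa using hβ
  have hr : 0 ≤ ‖β‖ ^ 2 - s ^ 2 := by linarith
  have hn : ∀ b : ℂ, ‖b‖ = 1 ↔ ‖conj β * b‖ ^ 2 = ‖β‖ ^ 2 := by
    intro b
    rw [norm_mul, RCLike.norm_conj, mul_pow]
    have : ‖β‖ ^ 2 ≠ 0 := by simpa using hβ
    rw [mul_eq_left₀ this, pow_eq_one_iff_of_nonneg (norm_nonneg b) two_ne_zero]
  ext b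
  simp only [lineCircle, mem_ofPred_eq, mem_insert_iff, mem_singleton_iff, eq_div_iff hc, hn,
    mul_comm b]
  generalize conj β * b = ω
  simp only [Complex.ext_iff, Complex.sq_norm ω, Complex.normSq_apply]
  constructor
  · rintro ⟨h1, h2⟩
    have : ω.im ^ 2 = √(‖β‖ ^ 2 - s ^ 2) ^ 2 := by
      rw [Real.sq_sqrt hr]; rw [h2] at h1; linarith
    rcases sq_eq_sq_iff_eq_or_eq_neg.1 this with h | h
    · exact Or.inl ⟨h2, h⟩
    · exact Or.inr ⟨h2, h⟩
  · rintro (⟨h1, h2⟩ | ⟨h1, h2⟩) <;> refine ⟨?_, h1⟩ <;> rw [h1, h2] <;>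
      nlinarith [Real.sq_sqrt hr]

lemma encard_lineCircle_eq_one {β : ℂ} {s : ℝ} (hβ : β ≠ 0) (h : s ^ 2 = ‖β‖ ^ 2) :
    (lineCircle β s).encard = 1 := by
  rw [lineCircle_eq_pair hβ h.le, h]
  simp

lemma encard_lineCircle_eq_two {β : ℂ} {s : ℝ} (hβ : β ≠ 0) (h : s ^ 2 < ‖β‖ ^ 2) :
    (lineCircle β s).encard = 2 := by
  have hc : conj β ≠ 0 := by simpa using hβ
  have hr : 0 < √(‖β‖ ^ 2 - s ^ 2) := Real.sqrt_pos.2 (by linarith)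
  rw [lineCircle_eq_pair hβ h.le]
  refine encard_pair fun h0 => ?_
  have := congrArg Complex.im ((div_left_inj' hc).1 h0)
  simp only at this
  linarith

/-- A circumscribing triangle is determined by its vertex common to the sides through `P` and `R`,
and that vertex is any fixed point on the circle of the composition of the three half-turns. -/
lemma encard_circumscribingTriangles {P Q R : ℂ} (hP : ‖P‖ < 1) (hQ : ‖Q‖ < 1) (hR : ‖R‖ < 1) :
    (circumscribingTriangles P Q R).encard =
      (lineCircle (turnB P Q R) (turnA P Q R).re).encard := by
  have himage : circumscribingTriangles P Q R =
      (fun b => ({otherEnd Q (otherEnd P b), b, otherEnd P b} : Set ℂ)) ''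
        lineCircle (turnB P Q R) (turnA P Q R).re := by
    ext T
    constructor
    · rintro ⟨a, b, c, -, -, -, rfl, ha, hb, hc, h1, h2, h3⟩
      rw [mem_sphere_zero_iff_norm] at ha hb hc
      rw [mem_segment_iff_eq_otherEnd hP hb hc] at h1
      rw [mem_segment_iff_eq_otherEnd hQ hc ha] at h2
      rw [mem_segment_iff_eq_otherEnd hR ha hb] at h3
      refine ⟨b, ⟨hb, (otherEnd_comp_eq_self_iff hP hQ hR hb).1 ?_⟩, ?_⟩
      · rw [← h1, ← h2, ← h3]
      · simp only [← h1, ← h2]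
    · rintro ⟨b, ⟨hb, hs⟩, rfl⟩
      have hs := (otherEnd_comp_eq_self_iff hP hQ hR hb).2 hs
      have hc := norm_otherEnd hP hb
      have ha := norm_otherEnd hQ hc
      refine ⟨_, b, _, ?_, (otherEnd_ne hP hb).symm, (otherEnd_ne hQ hc).symm, rfl,
        mem_sphere_zero_iff_norm.2 ha, mem_sphere_zero_iff_norm.2 hb,
        mem_sphere_zero_iff_norm.2 hc, (mem_segment_iff_eq_otherEnd hP hb hc).2 rfl,
        (mem_segment_iff_eq_otherEnd hQ hc ha).2 rfl,
        (mem_segment_iff_eq_otherEnd hR ha hb).2 hs.symm⟩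
      intro h
      exact otherEnd_ne hR ha (hs.trans h.symm)
  rw [himage]
  refine InjOn.encard_image ?_
  rintro b ⟨hb, hs⟩ b' ⟨hb', hs'⟩ heq
  have hs := (otherEnd_comp_eq_self_iff hP hQ hR hb).2 hs
  have hs' := (otherEnd_comp_eq_self_iff hP hQ hR hb').2 hs'
  simp only at heq
  have hc := norm_otherEnd hP hb
  have ha := norm_otherEnd hQ hc
  have hPb := otherEnd_otherEnd hP hb
  have hRa : otherEnd R b = otherEnd Q (otherEnd P b) := by
    rw [← hs, otherEnd_otherEnd hR ha, hs]
  have hRb' : otherEnd R b' = otherEnd Q (otherEnd P b') := by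
    rw [← hs', otherEnd_otherEnd hR (norm_otherEnd hQ (norm_otherEnd hP hb')), hs']
  have nba : b ≠ otherEnd Q (otherEnd P b) := hRa ▸ (otherEnd_ne hR hb).symm
  have nca := (otherEnd_ne hQ hc).symm
  have ncb := otherEnd_ne hP hb
  -- `b` is the only vertex that both involutions `otherEnd P` and `otherEnd R` send to a vertex
  have m1 : b' ∈ ({otherEnd Q (otherEnd P b), b, otherEnd P b} : Set ℂ) := by rw [heq]; simp
  have m2 : otherEnd P b' ∈ ({otherEnd Q (otherEnd P b), b, otherEnd P b} : Set ℂ) := by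
    rw [heq]; simp
  have m3 : otherEnd R b' ∈ ({otherEnd Q (otherEnd P b), b, otherEnd P b} : Set ℂ) := by
    rw [heq, hRb']; simp
  simp only [mem_insert_iff, mem_singleton_iff] at m1 m2 m3
  rcases m1 with h | h | h
  · exfalso
    have hinv := otherEnd_otherEnd hP hb'
    rcases m2 with h2 | h2 | h2
    · exact otherEnd_ne hP hb' (h2.trans h.symm)
    · rw [h2] at hinv; exact nca (hinv.trans h)
    · rw [h2, hPb] at hinv; exact nba (hinv.trans h)
  · exact h.symm
  · exfalso
    have hinv := otherEnd_otherEnd hR hb'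
    rcases m3 with h2 | h2 | h2
    · rw [h2, hs] at hinv; exact ncb (h.symm.trans hinv.symm)
    · rw [h2, hRa] at hinv; exact nca (h.symm.trans hinv.symm)
    · exact otherEnd_ne hR hb' (h2.trans h.symm)

lemma encard_circumscribingTriangles_eq_zero {P Q R : ℂ} (hP : ‖P‖ < 1) (hQ : ‖Q‖ < 1)
    (hR : ‖R‖ < 1)
    (h : (turnA P Q R).im ^ 2 < (1 - ‖P‖ ^ 2) * (1 - ‖Q‖ ^ 2) * (1 - ‖R‖ ^ 2)) :
    (circumscribingTriangles P Q R).encard = 0 := by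
  rw [encard_circumscribingTriangles hP hQ hR,
    lineCircle_eq_empty (by linarith [normSq_turnB P Q R]), encard_empty]

lemma encard_circumscribingTriangles_eq_one {P Q R : ℂ} (hP : ‖P‖ < 1) (hQ : ‖Q‖ < 1)
    (hR : ‖R‖ < 1)
    (h : (turnA P Q R).im ^ 2 = (1 - ‖P‖ ^ 2) * (1 - ‖Q‖ ^ 2) * (1 - ‖R‖ ^ 2)) :
    (circumscribingTriangles P Q R).encard = 1 := by
  have h' := normSq_turnB P Q R
  rw [encard_circumscribingTriangles hP hQ hR]
  exact encard_lineCircle_eq_one (turnB_ne_zero hP hQ (by linarith)) (by linarith)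

lemma encard_circumscribingTriangles_eq_two {P Q R : ℂ} (hP : ‖P‖ < 1) (hQ : ‖Q‖ < 1)
    (hR : ‖R‖ < 1)
    (h : (1 - ‖P‖ ^ 2) * (1 - ‖Q‖ ^ 2) * (1 - ‖R‖ ^ 2) < (turnA P Q R).im ^ 2) :
    (circumscribingTriangles P Q R).encard = 2 := by
  have h' := normSq_turnB P Q R
  rw [encard_circumscribingTriangles hP hQ hR]
  exact encard_lineCircle_eq_two (turnB_ne_zero hP hQ (by linarith)) (by linarith)

lemma exists_otherEnd_comp_eq_self_iff {P Q R : ℂ} (hP : ‖P‖ < 1) (hQ : ‖Q‖ < 1)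
    (hR : ‖R‖ < 1) :
    (∃ b : ℂ, ‖b‖ = 1 ∧ otherEnd R (otherEnd Q (otherEnd P b)) = b) ↔
      (1 - ‖P‖ ^ 2) * (1 - ‖Q‖ ^ 2) * (1 - ‖R‖ ^ 2) ≤ (turnA P Q R).im ^ 2 := by
  have h' := normSq_turnB P Q R
  have hset : (∃ b : ℂ, ‖b‖ = 1 ∧ otherEnd R (otherEnd Q (otherEnd P b)) = b) ↔
      (lineCircle (turnB P Q R) (turnA P Q R).re).Nonempty :=
    exists_congr fun b => and_congr_right fun hb => otherEnd_comp_eq_self_iff hP hQ hR hb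
  rw [hset]
  constructor
  · intro h
    by_contra! hlt
    exact h.ne_empty (lineCircle_eq_empty (by linarith))
  · intro h
    rw [lineCircle_eq_pair (turnB_ne_zero hP hQ (by linarith)) (by linarith)]
    exact insert_nonempty _ _

/-! ### The lift of the involution of a chord -/

lemma circlePt_coe (x : ℝ) :
    circlePt (x : UnitAddCircle) = Complex.exp (2 * Real.pi * x * Complex.I) := by
  rw [circlePt, AddCircle.toCircle_apply_mk, Circle.coe_exp]
  push_cast
  rw [div_one]

lemma norm_circlePt (t : UnitAddCircle) : ‖circlePt t‖ = 1 := Circle.norm_coe _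

lemma circlePt_injective : Function.Injective circlePt :=
  Subtype.val_injective.comp (AddCircle.injective_toCircle one_ne_zero)

lemma circlePt_add (s t : UnitAddCircle) : circlePt (s + t) = circlePt s * circlePt t := by
  rw [circlePt, AddCircle.toCircle_add, Circle.coe_mul]; rfl

lemma exists_circlePt_coe_eq {b : ℂ} (hb : ‖b‖ = 1) :
    ∃ x : ℝ, circlePt (x : UnitAddCircle) = b := by
  refine ⟨b.arg / (2 * Real.pi), ?_⟩
  have hpi : (Real.pi : ℂ) ≠ 0 := mod_cast Real.pi_ne_zero
  have h := Complex.norm_mul_exp_arg_mul_I b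
  rw [hb, Complex.ofReal_one, one_mul] at h
  rw [circlePt_coe, ← h]
  congr 1
  rw [h]
  push_cast
  field_simp

/-- Lift to `ℝ` of the involution `otherEnd X` of the circle, with values in `(x, x + 1)`. The
inscribed angle theorem gives the formula: the chord from `v` through `X` makes the angle
`arg (1 - X / v)` with the diameter through `v`. -/
noncomputable def chordLift (X : ℂ) (x : ℝ) : ℝ :=
  x + 1 / 2 + (1 - X * conj (circlePt (x : UnitAddCircle))).arg / Real.pi

lemma re_one_sub_mul_conj_pos {X v : ℂ} (hX : ‖X‖ < 1) (hv : ‖v‖ = 1) :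
    0 < (1 - X * conj v).re := by
  have := Complex.re_le_norm (X * conj v)
  rw [norm_mul, RCLike.norm_conj, hv, mul_one] at this
  simp only [Complex.sub_re, Complex.one_re]
  linarith

lemma lt_chordLift {X : ℂ} (hX : ‖X‖ < 1) (x : ℝ) : x < chordLift X x := by
  have h := (abs_lt.1 (Complex.abs_arg_lt_pi_div_two_iff.2
    (Or.inl (re_one_sub_mul_conj_pos hX (norm_circlePt (x : UnitAddCircle)))))).1
  have : -(1 / 2) < (1 - X * conj (circlePt (x : UnitAddCircle))).arg / Real.pi := by
    rw [lt_div_iff₀ Real.pi_pos]; linarith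
  rw [chordLift]; linarith

lemma chordLift_lt {X : ℂ} (hX : ‖X‖ < 1) (x : ℝ) : chordLift X x < x + 1 := by
  have h := (abs_lt.1 (Complex.abs_arg_lt_pi_div_two_iff.2
    (Or.inl (re_one_sub_mul_conj_pos hX (norm_circlePt (x : UnitAddCircle)))))).2
  have : (1 - X * conj (circlePt (x : UnitAddCircle))).arg / Real.pi < 1 / 2 := by
    rw [div_lt_iff₀ Real.pi_pos]; linarith
  rw [chordLift]; linarith

lemma chordLift_add_one (X : ℂ) (x : ℝ) : chordLift X (x + 1) = chordLift X x + 1 := by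
  have : ((x + 1 : ℝ) : UnitAddCircle) = (x : UnitAddCircle) := AddCircle.coe_add_period 1 x
  rw [chordLift, chordLift, this]
  ring

lemma continuous_circlePt : Continuous circlePt :=
  continuous_subtype_val.comp AddCircle.continuous_toCircle

lemma continuous_chordLift {X : ℂ} (hX : ‖X‖ < 1) : Continuous (chordLift X) := by
  have h1 : Continuous fun x : ℝ => 1 - X * conj (circlePt (x : UnitAddCircle)) :=
    continuous_const.sub (continuous_const.mul
      (Complex.continuous_conj.comp (continuous_circlePt.comp (AddCircle.continuous_mk' 1))))
  refine (continuous_id.add continuous_const).add (Continuous.div_const ?_ _)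
  refine continuous_iff_continuousAt.2 fun x => ?_
  exact ContinuousAt.comp (f := fun x : ℝ => 1 - X * conj (circlePt (x : UnitAddCircle)))
    (Complex.continuousAt_arg (Or.inl
      (re_one_sub_mul_conj_pos hX (norm_circlePt (x : UnitAddCircle))))) h1.continuousAt

lemma circlePt_chordLift {X : ℂ} (hX : ‖X‖ < 1) (x : ℝ) :
    circlePt (chordLift X x : UnitAddCircle) = otherEnd X (circlePt (x : UnitAddCircle)) := by
  have hv := norm_circlePt (x : UnitAddCircle)
  have ev := mul_conj_of_norm_eq_one hv
  rw [eq_otherEnd_iff hX hv]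
  have hpi : (Real.pi : ℂ) ≠ 0 := mod_cast Real.pi_ne_zero
  have h1 : circlePt (chordLift X x : UnitAddCircle) = circlePt (x : UnitAddCircle) * (-1) *
      (Complex.exp ((1 - X * conj (circlePt (x : UnitAddCircle))).arg * Complex.I)) ^ 2 := by
    rw [circlePt_coe (chordLift X x), ← Complex.exp_pi_mul_I, ← Complex.exp_nat_mul, chordLift]
    nth_rewrite 2 [circlePt_coe x]
    rw [← Complex.exp_add, ← Complex.exp_add]
    congr 1
    push_cast
    field_simp
  rw [h1]
  set v := circlePt (x : UnitAddCircle)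
  have h2 := Complex.norm_mul_exp_arg_mul_I (1 - X * conj v)
  set e := Complex.exp ((1 - X * conj v).arg * Complex.I) with he
  have ee : e * conj e = 1 := by
    refine mul_conj_of_norm_eq_one ?_
    rw [he, Complex.norm_exp_ofReal_mul_I]
  have h3 := congrArg conj h2
  simp only [map_mul, map_sub, map_one, Complex.conj_conj, Complex.conj_ofReal] at h3
  linear_combination (-v * e ^ 2) * h3 + v * h2 + v * e * (‖1 - X * conj v‖ : ℂ) * ee - X * ev

lemma exists_int_of_circlePt_eq {x y : ℝ}
    (h : circlePt (x : UnitAddCircle) = circlePt (y : UnitAddCircle)) : ∃ n : ℤ, y = x + n := by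
  have h1 : ((y - x : ℝ) : UnitAddCircle) = 0 := by
    rw [AddCircle.coe_sub, circlePt_injective h, sub_self]
  obtain ⟨n, hn⟩ := (AddCircle.coe_eq_zero_iff 1).1 h1
  refine ⟨n, ?_⟩
  simp at hn
  linarith

lemma chordLift_chordLift {X : ℂ} (hX : ‖X‖ < 1) (x : ℝ) :
    chordLift X (chordLift X x) = x + 1 := by
  have h : circlePt (x : UnitAddCircle) =
      circlePt (chordLift X (chordLift X x) : UnitAddCircle) := by
    rw [circlePt_chordLift hX, circlePt_chordLift hX, otherEnd_otherEnd hX (norm_circlePt _)]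
  obtain ⟨n, hn⟩ := exists_int_of_circlePt_eq h
  have h1 := lt_chordLift hX x
  have h2 := chordLift_lt hX x
  have h3 := lt_chordLift hX (chordLift X x)
  have h4 := chordLift_lt hX (chordLift X x)
  have h5 : (0 : ℝ) < n := by linarith
  have h6 : (n : ℝ) < 2 := by linarith
  have : n = 1 := by
    have h5' : 0 < n := mod_cast h5
    have h6' : n < 2 := mod_cast h6
    omega
  rw [hn, this, Int.cast_one]

lemma strictMono_chordLift {X : ℂ} (hX : ‖X‖ < 1) : StrictMono (chordLift X) := by
  have hinj : Function.Injective (chordLift X) := fun x y h => by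
    have := congrArg (chordLift X) h
    rw [chordLift_chordLift hX, chordLift_chordLift hX] at this
    linarith
  rcases (continuous_chordLift hX).strictMono_of_inj hinj with h | h
  · exact h
  · have h1 := h (zero_lt_one' ℝ)
    have h2 := chordLift_add_one X 0
    rw [zero_add] at h2
    linarith

/-! ### The lift of the bar billiard map -/

/-- The lift of the bar billiard map of the triangle `PQR`: going counterclockwise from `v`, the
first tangent chord is the first of the chords through a vertex. -/
noncomputable def barLift {P Q R : ℂ} (hP : ‖P‖ < 1) (hQ : ‖Q‖ < 1) (hR : ‖R‖ < 1) :
    CircleDeg1Lift where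
  toFun x := min (chordLift P x) (min (chordLift Q x) (chordLift R x))
  monotone' := (strictMono_chordLift hP).monotone.min
    ((strictMono_chordLift hQ).monotone.min (strictMono_chordLift hR).monotone)
  map_add_one' x := by
    simp only [chordLift_add_one, min_add_add_right]

lemma barLift_apply {P Q R : ℂ} (hP : ‖P‖ < 1) (hQ : ‖Q‖ < 1) (hR : ‖R‖ < 1) (x : ℝ) :
    barLift hP hQ hR x = min (chordLift P x) (min (chordLift Q x) (chordLift R x)) := rfl

lemma continuous_barLift {P Q R : ℂ} (hP : ‖P‖ < 1) (hQ : ‖Q‖ < 1) (hR : ‖R‖ < 1) :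
    Continuous (barLift hP hQ hR) :=
  (continuous_chordLift hP).min ((continuous_chordLift hQ).min (continuous_chordLift hR))

/-- Up to a positive factor, the (signed) distance of `Y` from the line `vw`, positive to the left
of the line directed from `v` to `w`. -/
noncomputable def side (v w Y : ℂ) : ℝ := (conj (w - v) * (Y - v)).im

lemma side_combo (v w : ℂ) {a b : ℝ} (hab : a + b = 1) (Y Z : ℂ) :
    side v w (a • Y + b • Z) = a * side v w Y + b * side v w Z := by
  have : conj (w - v) * (a • Y + b • Z - v) =
      a • (conj (w - v) * (Y - v)) + b • (conj (w - v) * (Z - v)) := by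
    have hab' : (a : ℂ) + b = 1 := mod_cast hab
    simp only [Complex.real_smul]
    linear_combination (conj (w - v) * v) * hab'
  rw [side, this, Complex.add_im, Complex.smul_im, Complex.smul_im]
  rfl

lemma side_eq_zero_of_mem_segment {v w Y : ℂ} (h : Y ∈ segment ℝ v w) : side v w Y = 0 := by
  obtain ⟨a, b, -, -, hab, rfl⟩ := h
  rw [side_combo v w hab]
  have h1 : side v w v = 0 := by simp [side]
  have h2 : side v w w = 0 := by
    rw [side, mul_comm, Complex.mul_conj, Complex.ofReal_im]
  rw [h1, h2]; ring

lemma convex_setOf_side_pos (v w : ℂ) : Convex ℝ {Y | 0 < side v w Y} := by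
  intro Y hY Z hZ a b ha hb hab
  have hY : 0 < side v w Y := hY
  have hZ : 0 < side v w Z := hZ
  change 0 < side v w _
  rw [side_combo v w hab]
  rcases ha.eq_or_lt with rfl | ha
  · have : b = 1 := by linarith
    rw [this]; linarith
  · have := mul_pos ha hY
    have := mul_nonneg hb hZ.le
    linarith

lemma convex_setOf_side_nonneg (v w : ℂ) : Convex ℝ {Y | 0 ≤ side v w Y} := by
  intro Y hY Z hZ a b ha hb hab
  change 0 ≤ side v w _
  rw [side_combo v w hab]
  exact add_nonneg (mul_nonneg ha hY) (mul_nonneg hb hZ)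

lemma side_pos_of_mem_interior {v w Y : ℂ} (hvw : v ≠ w)
    (h : Y ∈ interior {Y | 0 ≤ side v w Y}) : 0 < side v w Y := by
  have hc : conj (w - v) ≠ 0 := (map_ne_zero _).2 (sub_ne_zero.2 hvw.symm)
  have ho : IsOpenMap (side v w) :=
    Complex.isOpenMap_im.comp ((Homeomorph.mulLeft₀ _ hc).isOpenMap.comp
      (Homeomorph.subRight v).isOpenMap)
  have := ho.interior_preimage_subset_preimage_interior (s := Ici 0) h
  rwa [interior_Ici] at this

/-- The position of `X` relative to the chord from `x` to `x + s` is determined by comparing `s`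
with the parameter of the chord through `X`. -/
lemma side_circlePt {X : ℂ} (x s : ℝ) :
    side (circlePt (x : UnitAddCircle)) (circlePt ((x : UnitAddCircle) + (s : UnitAddCircle))) X =
      2 * Real.sin (Real.pi * s) * ‖1 - X * conj (circlePt (x : UnitAddCircle))‖ *
        Real.sin (Real.pi * (chordLift X x - x - s)) := by
  have ev := mul_conj_of_norm_eq_one (norm_circlePt (x : UnitAddCircle))
  have hangle : Real.pi * (chordLift X x - x - s) =
      Real.pi / 2 - (Real.pi * s - (1 - X * conj (circlePt (x : UnitAddCircle))).arg) := by
    rw [chordLift]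
    field_simp
    ring
  rw [hangle, Real.sin_pi_div_two_sub, Real.cos_sub, circlePt_add, side]
  set v := circlePt (x : UnitAddCircle)
  have h1 : conj (v * circlePt (s : UnitAddCircle) - v) * (X - v) =
      (1 - conj (circlePt (s : UnitAddCircle))) * (1 - X * conj v) := by
    rw [map_sub, map_mul]
    linear_combination (1 - conj (circlePt (s : UnitAddCircle))) * ev
  have h2 : circlePt (s : UnitAddCircle) =
      ⟨Real.cos (2 * (Real.pi * s)), Real.sin (2 * (Real.pi * s))⟩ := by
    rw [circlePt_coe]
    apply Complex.ext
    · rw [show (2 * Real.pi * s * Complex.I : ℂ) = ((2 * (Real.pi * s) : ℝ) : ℂ) * Complex.I by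
        push_cast; ring, Complex.exp_ofReal_mul_I_re]
    · rw [show (2 * Real.pi * s * Complex.I : ℂ) = ((2 * (Real.pi * s) : ℝ) : ℂ) * Complex.I by
        push_cast; ring, Complex.exp_ofReal_mul_I_im]
  have h3 : (1 - X * conj v).re = ‖1 - X * conj v‖ * Real.cos (1 - X * conj v).arg :=
    (Complex.norm_mul_cos_arg _).symm
  have h4 : (1 - X * conj v).im = ‖1 - X * conj v‖ * Real.sin (1 - X * conj v).arg :=
    (Complex.norm_mul_sin_arg _).symm
  rw [h1, Complex.mul_im, h3, h4, h2]
  simp only [Complex.sub_re, Complex.sub_im, Complex.one_re, Complex.one_im, Complex.conj_re,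
    Complex.conj_im]
  rw [Real.cos_two_mul, Real.sin_two_mul]
  linear_combination (-2 * ‖1 - X * conj v‖ * Real.sin (1 - X * conj v).arg) *
    Real.sin_sq_add_cos_sq (Real.pi * s)

lemma norm_one_sub_mul_conj_pos {X v : ℂ} (hX : ‖X‖ < 1) (hv : ‖v‖ = 1) :
    0 < ‖1 - X * conj v‖ :=
  (re_one_sub_mul_conj_pos hX hv).trans_le (Complex.re_le_norm _)

lemma sin_pi_mul_pos {s : ℝ} (h0 : 0 < s) (h1 : s < 1) : 0 < Real.sin (Real.pi * s) :=
  Real.sin_pos_of_pos_of_lt_pi (mul_pos Real.pi_pos h0) (by nlinarith [Real.pi_pos])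

lemma side_circlePt_pos {X : ℂ} (hX : ‖X‖ < 1) {x s : ℝ} (h0 : 0 < s) (h1 : s < 1)
    (hs : s < chordLift X x - x) :
    0 < side (circlePt (x : UnitAddCircle))
      (circlePt ((x : UnitAddCircle) + (s : UnitAddCircle))) X := by
  rw [side_circlePt]
  have a1 := sin_pi_mul_pos h0 h1
  have a2 := norm_one_sub_mul_conj_pos hX (norm_circlePt (x : UnitAddCircle))
  have a3 := sin_pi_mul_pos (s := chordLift X x - x - s) (by linarith)
    (by linarith [chordLift_lt hX x])
  positivity

lemma side_circlePt_nonneg {X : ℂ} (hX : ‖X‖ < 1) {x s : ℝ} (h0 : 0 < s) (h1 : s < 1)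
    (hs : s ≤ chordLift X x - x) :
    0 ≤ side (circlePt (x : UnitAddCircle))
      (circlePt ((x : UnitAddCircle) + (s : UnitAddCircle))) X := by
  rcases hs.eq_or_lt with h | h
  · rw [side_circlePt, ← h, sub_self, mul_zero, Real.sin_zero, mul_zero]
  · exact (side_circlePt_pos hX h0 h1 h).le

/-- A chord on whose left all vertices lie strictly misses the triangle; one on whose left all
vertices lie, with one vertex on it, is tangent. -/
lemma barMap_coe {P Q R : ℂ} (hP : ‖P‖ < 1) (hQ : ‖Q‖ < 1) (hR : ‖R‖ < 1) (x : ℝ) :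
    barMap P Q R (x : UnitAddCircle) = (barLift hP hQ hR x : UnitAddCircle) := by
  have hvert : ∀ s : ℝ, (∀ X : ℂ, X = P ∨ X = Q ∨ X = R → s ≤ chordLift X x - x) ↔
      s ≤ barLift hP hQ hR x - x := by
    intro s
    simp only [barLift_apply, forall_eq_or_imp, forall_eq, le_sub_iff_add_le, le_min_iff]
  have hnorm : ∀ X : ℂ, X = P ∨ X = Q ∨ X = R → ‖X‖ < 1 := by
    rintro X (rfl | rfl | rfl) <;> assumption
  have hex : ∃ X : ℂ, (X = P ∨ X = Q ∨ X = R) ∧ barLift hP hQ hR x = chordLift X x := by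
    rw [barLift_apply]
    rcases min_choice (chordLift P x) (min (chordLift Q x) (chordLift R x)) with h | h
    · exact ⟨P, by simp, h⟩
    · rcases min_choice (chordLift Q x) (chordLift R x) with h' | h'
      · exact ⟨Q, by simp, h.trans h'⟩
      · exact ⟨R, by simp, h.trans h'⟩
  obtain ⟨X, hXm, hX⟩ := hex
  have hX1 := hnorm X hXm
  have p0 : 0 < barLift hP hQ hR x - x := by rw [hX]; linarith [lt_chordLift hX1 x]
  have p1 : barLift hP hQ hR x - x < 1 := by rw [hX]; linarith [chordLift_lt hX1 x]
  have hleast : IsLeast {s : ℝ | s ∈ Ioo (0 : ℝ) 1 ∧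
      IsTangentChord P Q R (x : UnitAddCircle) ((x : UnitAddCircle) + (s : UnitAddCircle))}
      (barLift hP hQ hR x - x) := by
    constructor
    · have hpt : (x : UnitAddCircle) + ((barLift hP hQ hR x - x : ℝ) : UnitAddCircle) =
          (chordLift X x : UnitAddCircle) := by
        rw [← AddCircle.coe_add, hX]; congr 1; ring
      have hw : circlePt ((x : UnitAddCircle) + ((barLift hP hQ hR x - x : ℝ) : UnitAddCircle)) =
          otherEnd X (circlePt (x : UnitAddCircle)) := by
        rw [hpt, circlePt_chordLift hX1]
      have hv := norm_circlePt (x : UnitAddCircle)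
      refine ⟨⟨p0, p1⟩, ⟨X, ?_, ?_⟩, ?_⟩
      · rw [hw, mem_segment_iff_eq_otherEnd hX1 hv (norm_otherEnd hX1 hv)]
      · exact subset_convexHull ℝ _ (by simpa using hXm)
      · rw [disjoint_left]
        intro Y hY hYi
        refine (side_pos_of_mem_interior ?_ (interior_mono (convexHull_min ?_
          (convex_setOf_side_nonneg _ _)) hYi)).ne' (side_eq_zero_of_mem_segment hY)
        · rw [hw]; exact (otherEnd_ne hX1 hv).symm
        · intro Z hZ
          have hZ : Z = P ∨ Z = Q ∨ Z = R := by simpa using hZ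
          exact side_circlePt_nonneg (hnorm Z hZ) p0 p1 ((hvert _).2 le_rfl Z hZ)
    · rintro s ⟨⟨h0, h1⟩, ⟨Y, hY, hYK⟩, -⟩
      by_contra! hlt
      have hsub : convexHull ℝ {P, Q, R} ⊆ {Y | 0 < side (circlePt (x : UnitAddCircle))
          (circlePt ((x : UnitAddCircle) + (s : UnitAddCircle))) Y} := by
        refine convexHull_min ?_ (convex_setOf_side_pos _ _)
        intro Z hZ
        have hZ : Z = P ∨ Z = Q ∨ Z = R := by simpa using hZ
        exact side_circlePt_pos (hnorm Z hZ) h0 h1 (hlt.trans_le ((hvert _).2 le_rfl Z hZ))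
      have hpos : 0 < side _ _ Y := hsub hYK
      exact hpos.ne' (side_eq_zero_of_mem_segment hY)
  rw [barMap, hleast.csInf_eq, ← AddCircle.coe_add]
  congr 1
  ring

lemma isLift_barLift {P Q R : ℂ} (hP : ‖P‖ < 1) (hQ : ‖Q‖ < 1) (hR : ‖R‖ < 1) :
    IsLift (barLift hP hQ hR) (barMap P Q R) := by
  refine ⟨continuous_barLift hP hQ hR, ⟨?_, ?_⟩, fun x => (barMap_coe hP hQ hR x).symm⟩
  · rw [barLift_apply]
    exact lt_min (lt_chordLift hP 0) (lt_min (lt_chordLift hQ 0) (lt_chordLift hR 0))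
  · rw [barLift_apply]
    exact (min_le_left _ _).trans_lt ((chordLift_lt hP 0).trans_eq (zero_add 1))

/-- Two lifts of the same map differ by a continuous function with integer values. -/
lemma IsLift.unique {F G : CircleDeg1Lift} {f : UnitAddCircle → UnitAddCircle} (hF : IsLift F f)
    (hG : IsLift G f) : F = G := by
  have hint : ∀ x, ∃ n : ℤ, F x - G x = n := by
    intro x
    have h1 : ((F x - G x : ℝ) : UnitAddCircle) = 0 := by
      rw [AddCircle.coe_sub, hF.2.2, hG.2.2, sub_self]
    obtain ⟨n, hn⟩ := (AddCircle.coe_eq_zero_iff 1).1 h1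
    exact ⟨n, by rw [← hn]; simp⟩
  choose n hn using hint
  have hcont : Continuous n := by
    have : Continuous fun x => ((n x : ℤ) : ℝ) := by
      simp only [← hn]; exact hF.1.sub hG.1
    exact Int.isClosedEmbedding_coe_real.isEmbedding.continuous_iff.2 this
  have h0 : n 0 = 0 := by
    have h1 := hn 0
    obtain ⟨a, b⟩ := hF.2.1
    obtain ⟨c, d⟩ := hG.2.1
    have h2 : (-1 : ℝ) < n 0 := by linarith
    have h3 : (n 0 : ℝ) < 1 := by linarith
    have h2' : -1 < n 0 := mod_cast h2
    have h3' : n 0 < 1 := mod_cast h3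
    omega
  ext x
  have := hn x
  rw [PreconnectedSpace.constant (inferInstance : PreconnectedSpace ℝ) hcont (x := x) (y := 0),
    h0, Int.cast_zero] at this
  linarith

/-! ### Rotation number one third -/

/-- When three lifted half-turns lead once around the circle, the first of them moves the starting
point less than the other two would. -/
lemma chordLift_le_of_cycle {X Y Z : ℂ} (hY : ‖Y‖ < 1) (hZ : ‖Z‖ < 1) {x : ℝ}
    (h : chordLift Z (chordLift Y (chordLift X x)) = x + 1) :
    chordLift X x ≤ chordLift Y x ∧ chordLift X x ≤ chordLift Z x := by
  have h1 := lt_chordLift hY (chordLift X x)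
  constructor
  · by_contra! hlt
    have h2 := strictMono_chordLift hY hlt
    rw [chordLift_chordLift hY] at h2
    linarith [lt_chordLift hZ (chordLift Y (chordLift X x))]
  · have : chordLift Z x = chordLift Y (chordLift X x) :=
      (strictMono_chordLift hZ).injective ((chordLift_chordLift hZ x).trans h.symm)
    rw [this]; exact h1.le

lemma barLift_iterate_of_cycle {P Q R : ℂ} (hP : ‖P‖ < 1) (hQ : ‖Q‖ < 1) (hR : ‖R‖ < 1) {x : ℝ}
    (h : chordLift R (chordLift Q (chordLift P x)) = x + 1) :
    barLift hP hQ hR (barLift hP hQ hR (barLift hP hQ hR x)) = x + 1 := by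
  have h' : chordLift P (chordLift R (chordLift Q (chordLift P x))) = chordLift P x + 1 := by
    rw [h, chordLift_add_one]
  have h'' : chordLift Q (chordLift P (chordLift R (chordLift Q (chordLift P x)))) =
      chordLift Q (chordLift P x) + 1 := by
    rw [h', chordLift_add_one]
  have c1 := chordLift_le_of_cycle hQ hR h
  have c2 := chordLift_le_of_cycle hR hP h'
  have c3 := chordLift_le_of_cycle hP hQ h''
  have e1 : barLift hP hQ hR x = chordLift P x := by
    rw [barLift_apply]; exact min_eq_left (le_min c1.1 c1.2)
  have e2 : barLift hP hQ hR (chordLift P x) = chordLift Q (chordLift P x) := by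
    rw [barLift_apply, min_eq_left c2.1, min_eq_right c2.2]
  have e3 : barLift hP hQ hR (chordLift Q (chordLift P x)) = x + 1 := by
    rw [barLift_apply, min_eq_right c3.2, min_eq_right c3.1, h]
  rw [e1, e2, e3]

lemma barLift_comm {P Q R : ℂ} (hP : ‖P‖ < 1) (hQ : ‖Q‖ < 1) (hR : ‖R‖ < 1) :
    barLift hP hQ hR = barLift hR hQ hP := by
  ext x
  rw [barLift_apply, barLift_apply, min_comm (chordLift Q x), min_left_comm,
    min_comm (chordLift P x), min_left_comm]

lemma turnA_im (P Q R : ℂ) : (turnA P Q R).im =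
    (Q.re * P.im - Q.im * P.re) + (R.re * Q.im - R.im * Q.re) + (P.re * R.im - P.im * R.re) := by
  simp only [turnA, Complex.sub_im, Complex.add_im, Complex.mul_im, Complex.conj_re,
    Complex.conj_im, Complex.one_im]
  ring

/-- The bar billiard map has an orbit of period three that goes once around the circle exactly when
the composition of the half-turns about the vertices satisfies the fixed point criterion. -/
lemma exists_cycle_iff {P Q R : ℂ} (hP : ‖P‖ < 1) (hQ : ‖Q‖ < 1) (hR : ‖R‖ < 1) :
    (∃ x, barLift hP hQ hR (barLift hP hQ hR (barLift hP hQ hR x)) = x + 1) ↔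
      (1 - ‖P‖ ^ 2) * (1 - ‖Q‖ ^ 2) * (1 - ‖R‖ ^ 2) ≤ (turnA P Q R).im ^ 2 := by
  constructor
  · rintro ⟨x, hx⟩
    let V : Fin 3 → ℂ := ![P, Q, R]
    have hV : ∀ i, ‖V i‖ < 1 := by
      intro i; fin_cases i <;> assumption
    have hmin : ∀ y, ∃ i, barLift hP hQ hR y = chordLift (V i) y := by
      intro y
      rw [barLift_apply]
      rcases min_choice (chordLift P y) (min (chordLift Q y) (chordLift R y)) with h | h
      · exact ⟨0, h⟩
      · rcases min_choice (chordLift Q y) (chordLift R y) with h' | h'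
        · exact ⟨1, h.trans h'⟩
        · exact ⟨2, h.trans h'⟩
    obtain ⟨i, hi⟩ := hmin x
    obtain ⟨j, hj⟩ := hmin (barLift hP hQ hR x)
    obtain ⟨l, hl⟩ := hmin (barLift hP hQ hR (barLift hP hQ hR x))
    rw [hl, hj, hi] at hx
    -- two steps with the same vertex make a full turn, which is too much for three steps
    have hij : i ≠ j := by
      rintro rfl
      rw [chordLift_chordLift (hV i)] at hx
      linarith [lt_chordLift (hV l) (x + 1)]
    have hjl : j ≠ l := by
      rintro rfl
      rw [chordLift_chordLift (hV j)] at hx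
      linarith [lt_chordLift (hV i) x]
    have hil : i ≠ l := by
      rintro rfl
      have := congrArg (chordLift (V i)) hx
      rw [chordLift_chordLift (hV i), chordLift_add_one] at this
      linarith [lt_chordLift (hV j) (chordLift (V i) x)]
    have hfix : ∃ b : ℂ, ‖b‖ = 1 ∧ otherEnd (V l) (otherEnd (V j) (otherEnd (V i) b)) = b := by
      refine ⟨circlePt (x : UnitAddCircle), norm_circlePt _, ?_⟩
      rw [← circlePt_chordLift (hV i), ← circlePt_chordLift (hV j), ← circlePt_chordLift (hV l),
        hx]
      exact congrArg circlePt (AddCircle.coe_add_period 1 x)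
    rw [exists_otherEnd_comp_eq_self_iff (hV i) (hV j) (hV l)] at hfix
    -- the criterion is symmetric in the three vertices
    revert hij hjl hil hfix
    simp only [turnA_im]
    clear hi hj hl hx
    fin_cases i <;> fin_cases j <;> fin_cases l <;> intro h1 h2 h3 h <;>
      first
      | exact absurd rfl h1
      | exact absurd rfl h2
      | exact absurd rfl h3
      | (simp [V] at h; linarith)
  · intro h
    obtain ⟨b, hb, hfix⟩ := (exists_otherEnd_comp_eq_self_iff hP hQ hR).2 h
    obtain ⟨x, rfl⟩ := exists_circlePt_coe_eq hb
    rw [← circlePt_chordLift hP, ← circlePt_chordLift hQ, ← circlePt_chordLift hR] at hfix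
    obtain ⟨n, hn⟩ := exists_int_of_circlePt_eq hfix.symm
    have h1 := lt_chordLift hP x
    have h2 := chordLift_lt hP x
    have h3 := lt_chordLift hQ (chordLift P x)
    have h4 := chordLift_lt hQ (chordLift P x)
    have h5 := lt_chordLift hR (chordLift Q (chordLift P x))
    have h6 := chordLift_lt hR (chordLift Q (chordLift P x))
    have n0 : (0 : ℝ) < n := by linarith
    have n3 : (n : ℝ) < 3 := by linarith
    have n0' : 0 < n := mod_cast n0
    have n3' : n < 3 := mod_cast n3
    obtain rfl | rfl : n = 1 ∨ n = 2 := by omega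
    · exact ⟨x, barLift_iterate_of_cycle hP hQ hR (by simpa using hn)⟩
    · -- the cycle runs twice around the circle, so the inverse cycle runs around it once
      have hn : chordLift R (chordLift Q (chordLift P x)) = x + 1 + 1 := by
        rw [hn]; push_cast; ring
      refine ⟨x + 1 + 1, ?_⟩
      rw [barLift_comm]
      refine barLift_iterate_of_cycle hR hQ hP ?_
      have e1 : chordLift R (x + 1 + 1) = chordLift Q (chordLift P x) + 1 := by
        rw [← hn, chordLift_chordLift hR]
      rw [e1, chordLift_add_one, chordLift_chordLift hQ, chordLift_add_one, chordLift_add_one,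
        chordLift_chordLift hP]

lemma translationNumber_barLift_eq_iff {P Q R : ℂ} (hP : ‖P‖ < 1) (hQ : ‖Q‖ < 1) (hR : ‖R‖ < 1) :
    (barLift hP hQ hR).translationNumber = 1 / 3 ↔
      (1 - ‖P‖ ^ 2) * (1 - ‖Q‖ ^ 2) * (1 - ‖R‖ ^ 2) ≤ (turnA P Q R).im ^ 2 := by
  rw [← exists_cycle_iff hP hQ hR]
  have := (barLift hP hQ hR).translationNumber_eq_rat_iff (continuous_barLift hP hQ hR) (m := 1)
    (n := 3) (by norm_num)
  simpa [CircleDeg1Lift.coe_pow] using this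

/-! ### The hyperbolic distance in the Beltrami–Klein model -/

lemma cosh_kleinDist {P Q : ℂ} (hP : ‖P‖ < 1) (hQ : ‖Q‖ < 1) :
    Real.cosh (kleinDist P Q) * (√(1 - ‖P‖ ^ 2) * √(1 - ‖Q‖ ^ 2)) =
      1 - (P.re * Q.re + P.im * Q.im) := by
  have pP : 0 < 1 - ‖P‖ ^ 2 := by nlinarith [norm_nonneg P]
  have pQ : 0 < 1 - ‖Q‖ ^ 2 := by nlinarith [norm_nonneg Q]
  set a := √(1 - ‖P‖ ^ 2) with ha
  set b := √(1 - ‖Q‖ ^ 2) with hb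
  have a0 : 0 < a := Real.sqrt_pos.2 pP
  have b0 : 0 < b := Real.sqrt_pos.2 pQ
  have a2 : a ^ 2 = 1 - (P.re * P.re + P.im * P.im) := by
    rw [ha, Real.sq_sqrt pP.le, Complex.sq_norm, Complex.normSq_apply]
  have b2 : b ^ 2 = 1 - (Q.re * Q.re + Q.im * Q.im) := by
    rw [hb, Real.sq_sqrt pQ.le, Complex.sq_norm, Complex.normSq_apply]
  have nP : 1 - ‖kleinToPoincare P‖ ^ 2 = 2 * a / (1 + a) := by
    rw [kleinToPoincare, ← ha, norm_smul, mul_pow, Real.norm_eq_abs, sq_abs, Complex.sq_norm,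
      Complex.normSq_apply, eq_div_iff (by positivity)]
    field_simp
    linear_combination -a2
  have nQ : 1 - ‖kleinToPoincare Q‖ ^ 2 = 2 * b / (1 + b) := by
    rw [kleinToPoincare, ← hb, norm_smul, mul_pow, Real.norm_eq_abs, sq_abs, Complex.sq_norm,
      Complex.normSq_apply, eq_div_iff (by positivity)]
    field_simp
    linear_combination -b2
  have nPQ : ‖kleinToPoincare P - kleinToPoincare Q‖ ^ 2 =
      2 * (1 - (P.re * Q.re + P.im * Q.im) - a * b) / ((1 + a) * (1 + b)) := by
    rw [kleinToPoincare, kleinToPoincare, ← ha, ← hb, Complex.sq_norm, Complex.normSq_apply]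
    simp only [Complex.sub_re, Complex.sub_im, Complex.smul_re, Complex.smul_im, smul_eq_mul]
    field_simp
    linear_combination (1 + b) ^ 2 * a2 + (1 + a) ^ 2 * b2
  have hone : 1 ≤ 1 + 2 * ‖kleinToPoincare P - kleinToPoincare Q‖ ^ 2 /
      ((1 - ‖kleinToPoincare P‖ ^ 2) * (1 - ‖kleinToPoincare Q‖ ^ 2)) := by
    rw [nP, nQ]
    have : 0 ≤ 2 * ‖kleinToPoincare P - kleinToPoincare Q‖ ^ 2 /
      ((2 * a / (1 + a)) * (2 * b / (1 + b))) := by positivity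
    linarith
  rw [kleinDist, poincareDist, Real.cosh_arcosh hone, nP, nQ, nPQ]
  field_simp
  ring

/-! ### Coordinates in the rotated frame -/

lemma eq_frame_iff {e z : ℂ} (he : ‖e‖ = 1) {x y : ℝ} :
    z = x • e + y • (Complex.I * e) ↔ (z * conj e).re = x ∧ (z * conj e).im = y := by
  have ee := mul_conj_of_norm_eq_one he
  have h : z = x • e + y • (Complex.I * e) ↔ z * conj e = ⟨x, y⟩ := by
    rw [← Complex.re_add_im (⟨x, y⟩ : ℂ)]
    simp only [Complex.real_smul]
    constructor
    · intro h
      linear_combination conj e * h + (x + y * Complex.I) * ee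
    · intro h
      linear_combination e * h - z * ee
  rw [h, Complex.ext_iff]

lemma norm_sq_frame {e : ℂ} (he : ‖e‖ = 1) (z : ℂ) :
    ‖z‖ ^ 2 = (z * conj e).re ^ 2 + (z * conj e).im ^ 2 := by
  have : ‖z‖ = ‖z * conj e‖ := by rw [norm_mul, RCLike.norm_conj, he, mul_one]
  rw [this, Complex.sq_norm, Complex.normSq_apply]
  ring

lemma re_mul_re_add_frame {e : ℂ} (he : ‖e‖ = 1) (z w : ℂ) :
    z.re * w.re + z.im * w.im =
      (z * conj e).re * (w * conj e).re + (z * conj e).im * (w * conj e).im := by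
  have h : e.re * e.re + e.im * e.im = 1 := by
    rw [← Complex.normSq_apply, ← Complex.sq_norm, he, one_pow]
  simp only [Complex.mul_re, Complex.mul_im, Complex.conj_re, Complex.conj_im]
  linear_combination -(z.re * w.re + z.im * w.im) * h

lemma turnA_im_frame {e : ℂ} (he : ‖e‖ = 1) {P Q R : ℂ}
    (hPQ : (Q * conj e).re = (P * conj e).re) :
    (turnA P Q R).im = ((P * conj e).im - (Q * conj e).im) *
      ((P * conj e).re - (R * conj e).re) := by
  have h : e.re * e.re + e.im * e.im = 1 := by
    rw [← Complex.normSq_apply, ← Complex.sq_norm, he, one_pow]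
  have hrot : (turnA P Q R).im = (turnA (P * conj e) (Q * conj e) (R * conj e)).im := by
    rw [turnA_im, turnA_im]
    simp only [Complex.mul_re, Complex.mul_im, Complex.conj_re, Complex.conj_im]
    linear_combination -((Q.re * P.im - Q.im * P.re) + (R.re * Q.im - R.im * Q.re) +
      (P.re * R.im - P.im * R.re)) * h
  rw [hrot, turnA_im, hPQ]
  ring

lemma mem_ellipse_iff {e z : ℂ} (he : ‖e‖ = 1) {A B C : ℝ} :
    z ∈ ellipse e (Complex.I * e) A B C ↔
      ((z * conj e).re - C) ^ 2 / A ^ 2 + (z * conj e).im ^ 2 / B ^ 2 = 1 := by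
  constructor
  · rintro ⟨x, y, h, h1⟩
    obtain ⟨rfl, rfl⟩ := (eq_frame_iff he).1 h
    exact h1
  · exact fun h => ⟨_, _, (eq_frame_iff he).2 ⟨rfl, rfl⟩, h⟩

lemma mem_ellipseInner_iff {e z : ℂ} (he : ‖e‖ = 1) {A B C : ℝ} :
    z ∈ ellipseInner e (Complex.I * e) A B C ↔
      ((z * conj e).re - C) ^ 2 / A ^ 2 + (z * conj e).im ^ 2 / B ^ 2 < 1 := by
  constructor
  · rintro ⟨x, y, h, h1⟩
    obtain ⟨rfl, rfl⟩ := (eq_frame_iff he).1 h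
    exact h1
  · exact fun h => ⟨_, _, (eq_frame_iff he).2 ⟨rfl, rfl⟩, h⟩

lemma mem_closure_ellipseInner_iff {e z : ℂ} (he : ‖e‖ = 1) {A B C : ℝ} :
    z ∈ closure (ellipseInner e (Complex.I * e) A B C) ↔
      ((z * conj e).re - C) ^ 2 / A ^ 2 + (z * conj e).im ^ 2 / B ^ 2 ≤ 1 := by
  constructor
  · intro h
    have hcl : IsClosed {z : ℂ |
        ((z * conj e).re - C) ^ 2 / A ^ 2 + (z * conj e).im ^ 2 / B ^ 2 ≤ 1} := by
      refine isClosed_le ?_ continuous_const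
      fun_prop
    refine closure_minimal (fun w hw => ?_) hcl h
    exact ((mem_ellipseInner_iff he).1 hw).le
  · intro h
    -- contract towards the centre of the ellipse
    let f : ℝ → ℂ := fun t => t • z + (1 - t) • (C • e)
    have hf : Filter.Tendsto f (nhdsWithin 1 (Ioo 0 1)) (nhds z) := by
      have hc : Continuous f := by fun_prop
      have := hc.tendsto 1
      simp only [f, one_smul, sub_self, zero_smul, add_zero] at this
      exact this.mono_left nhdsWithin_le_nhds
    have : (nhdsWithin (1 : ℝ) (Ioo 0 1)).NeBot := right_nhdsWithin_Ioo_neBot zero_lt_one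
    refine mem_closure_of_tendsto hf ?_
    filter_upwards [self_mem_nhdsWithin] with t ht
    rw [mem_ellipseInner_iff he]
    have hft : f t * conj e = t * (z * conj e) + (1 - t) * C := by
      simp only [f, Complex.real_smul]
      push_cast
      linear_combination ((1 - t) * C) * mul_conj_of_norm_eq_one he
    have hre : (f t * conj e).re - C = t * ((z * conj e).re - C) := by
      rw [hft, show ((1 : ℂ) - t) * C = (((1 - t) * C : ℝ) : ℂ) by push_cast; ring,
        Complex.add_re, Complex.re_ofReal_mul, Complex.ofReal_re]
      ring
    have him : (f t * conj e).im = t * (z * conj e).im := by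
      rw [hft, show ((1 : ℂ) - t) * C = (((1 - t) * C : ℝ) : ℂ) by push_cast; ring,
        Complex.add_im, Complex.im_ofReal_mul, Complex.ofReal_im]
      ring
    rw [hre, him, mul_pow, mul_pow, mul_div_assoc, mul_div_assoc, ← mul_add]
    have ht2 : t ^ 2 < 1 := by nlinarith [ht.1, ht.2]
    have hnn : 0 ≤ ((z * conj e).re - C) ^ 2 / A ^ 2 + (z * conj e).im ^ 2 / B ^ 2 := by positivity
    nlinarith [sq_nonneg t]

/-! ### The ellipse with double contact -/

/-- The conic `x² + y² + κ (x - u)² = 1`, which has double contact with the unit circle along the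
line `x = u`, in terms of its centre and half-axes. -/
lemma ellipse_equation {κ u Y x y : ℝ} (hκ : 0 ≤ κ) (hY : 0 < Y)
    (hY2 : Y ^ 2 = 1 + κ * (1 - u ^ 2)) :
    (x - κ * u / (1 + κ)) ^ 2 / (Y / (1 + κ)) ^ 2 + y ^ 2 / (Y / √(1 + κ)) ^ 2 =
      1 + (x ^ 2 + y ^ 2 + κ * (x - u) ^ 2 - 1) * ((1 + κ) / Y ^ 2) := by
  have h1 : 0 < 1 + κ := by linarith
  rw [div_pow Y (√(1 + κ)), Real.sq_sqrt h1.le]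
  field_simp
  linear_combination -hY2

/-- With `Y = cosh d`, `k = exp d` and `κ = sinh² d / (1 - u²)` the half-axes and the centre of
`ellipse_equation` take the form that uses `k` and `u` only. -/
lemma ellipse_axes {κ u Y k : ℝ} (hκ : 0 ≤ κ) (hu : u ^ 2 < 1) (hk : 0 < k)
    (hkY : k ^ 2 + 1 = 2 * k * Y) (hY : 0 < Y) (hY2 : Y ^ 2 = 1 + κ * (1 - u ^ 2)) :
    0 < (k ^ 2 - 2 * k * u + 1) * (k ^ 2 + 2 * k * u + 1) ∧
    2 * k * (k ^ 2 + 1) * (1 - u ^ 2) / ((k ^ 2 - 2 * k * u + 1) * (k ^ 2 + 2 * k * u + 1)) =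
      Y / (1 + κ) ∧
    (k ^ 2 + 1) * √(1 - u ^ 2) / √((k ^ 2 - 2 * k * u + 1) * (k ^ 2 + 2 * k * u + 1)) =
      Y / √(1 + κ) ∧
    (k ^ 2 - 1) ^ 2 * u / ((k ^ 2 - 2 * k * u + 1) * (k ^ 2 + 2 * k * u + 1)) =
      κ * u / (1 + κ) := by
  have h1 : 0 < 1 + κ := by linarith
  have hw : 0 < 1 - u ^ 2 := by linarith
  have hN : (k ^ 2 - 2 * k * u + 1) * (k ^ 2 + 2 * k * u + 1) =
      (2 * k) ^ 2 * ((1 - u ^ 2) * (1 + κ)) := by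
    linear_combination (k ^ 2 + 1 + 2 * k * Y) * hkY + 4 * k ^ 2 * hY2
  have hs : (k ^ 2 - 1) ^ 2 = (2 * k) ^ 2 * (κ * (1 - u ^ 2)) := by
    linear_combination (k ^ 2 + 1 + 2 * k * Y) * hkY + 4 * k ^ 2 * hY2
  rw [hN]
  refine ⟨by positivity, ?_, ?_, ?_⟩
  · rw [hkY]; field_simp
  · have s1 : 0 < √(1 - u ^ 2) := Real.sqrt_pos.2 hw
    have s2 : 0 < √(1 + κ) := Real.sqrt_pos.2 h1
    rw [Real.sqrt_mul (by positivity), Real.sqrt_sq (by positivity), Real.sqrt_mul hw.le, hkY]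
    field_simp
  · rw [hs]; field_simp

/-- The half-axes and the centre in terms of the parameter `a`, whose denominator is `d`. -/
lemma ellipse_axes_eq_of_parameter {k u d a : ℝ} (hk : 0 < k) (hu : u ^ 2 < 1)
    (hd : d = u * (k ^ 2 - 1) - 2 * k * √(1 - u ^ 2)) (hd0 : d ≠ 0) (ha : a = (k ^ 2 - 1) / d)
    (hN : 0 < (k ^ 2 - 2 * k * u + 1) * (k ^ 2 + 2 * k * u + 1)) :
    0 < (u ^ 2 + 1) * a ^ 2 - 2 * a * u + 1 ∧ 0 ≤ a ^ 2 - 2 * u * a + 1 ∧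
    2 * k * (k ^ 2 + 1) * (1 - u ^ 2) / ((k ^ 2 - 2 * k * u + 1) * (k ^ 2 + 2 * k * u + 1)) =
      |a * u - 1| * √(a ^ 2 - 2 * u * a + 1) / ((u ^ 2 + 1) * a ^ 2 - 2 * a * u + 1) ∧
    (k ^ 2 + 1) * √(1 - u ^ 2) / √((k ^ 2 - 2 * k * u + 1) * (k ^ 2 + 2 * k * u + 1)) =
      √(a ^ 2 - 2 * u * a + 1) / √((u ^ 2 + 1) * a ^ 2 - 2 * a * u + 1) ∧
    (k ^ 2 - 1) ^ 2 * u / ((k ^ 2 - 2 * k * u + 1) * (k ^ 2 + 2 * k * u + 1)) =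
      a ^ 2 * u / ((u ^ 2 + 1) * a ^ 2 - 2 * a * u + 1) := by
  have hw : 0 < 1 - u ^ 2 := by linarith
  have w0 : 0 < √(1 - u ^ 2) := Real.sqrt_pos.2 hw
  have w2 : √(1 - u ^ 2) ^ 2 = 1 - u ^ 2 := Real.sq_sqrt hw.le
  rw [← w2, Real.sqrt_sq w0.le]
  set w := √(1 - u ^ 2)
  generalize hNdef : (k ^ 2 - 2 * k * u + 1) * (k ^ 2 + 2 * k * u + 1) = N at hN ⊢
  have d2 : 0 < d ^ 2 := by positivity
  have habs : 0 < |d| := abs_pos.2 hd0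
  have had : a * d = k ^ 2 - 1 := by rw [ha]; field_simp
  have eM : (u ^ 2 + 1) * a ^ 2 - 2 * a * u + 1 = N / d ^ 2 := by
    rw [eq_div_iff d2.ne', ← hNdef]
    linear_combination ((u ^ 2 + 1) * (a * d + (k ^ 2 - 1)) - 2 * u * d) * had +
      (d - u * (k ^ 2 - 1) - 2 * k * w) * hd + 4 * k ^ 2 * w2
  have eQ : a ^ 2 - 2 * u * a + 1 = (w * (k ^ 2 + 1) / |d|) ^ 2 := by
    rw [div_pow, sq_abs, eq_div_iff d2.ne']
    linear_combination ((a * d + (k ^ 2 - 1)) - 2 * u * d) * had +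
      (d - u * (k ^ 2 - 1) - 2 * k * w) * hd + (-(k ^ 2 - 1) ^ 2) * w2
  have eau : |a * u - 1| = 2 * k * w / |d| := by
    have : a * u - 1 = 2 * k * w / d := by
      rw [eq_div_iff hd0]
      linear_combination u * had - hd
    rw [this, abs_div, abs_of_pos (by positivity : 0 < 2 * k * w)]
  rw [eM, eQ, eau, Real.sqrt_sq (by positivity), Real.sqrt_div hN.le, Real.sqrt_sq_eq_abs]
  have sN : 0 < √N := Real.sqrt_pos.2 hN
  refine ⟨by positivity, by positivity, ?_, ?_, ?_⟩
  · field_simp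
    rw [sq_abs]
  · field_simp
  · rw [← had]; field_simp

/-! ### Tangency to the unit circle -/

/-- The tangent cone of a set that lies in the level set of a differentiable function and contains
a differentiable curve through the point in question. -/
lemma tangentConeAt_eq_ker {S : Set ℂ} {z τ : ℂ} {g : ℂ → ℝ} {g' : ℂ →L[ℝ] ℝ} {γ : ℝ → ℂ}
    (hg : HasFDerivAt g g' z) (hS : ∀ y ∈ S, g y = g z) (hγ : HasDerivAt γ τ 0) (hγ0 : γ 0 = z)
    (hγS : ∀ t, γ t ∈ S) (hker : ∀ y, g' y = 0 → ∃ r : ℝ, y = r • τ) :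
    tangentConeAt ℝ S z = {y | g' y = 0} := by
  refine Subset.antisymm (fun y hy => ?_) (fun y hy => ?_)
  · have h0 : HasFDerivWithinAt g (0 : ℂ →L[ℝ] ℝ) S z :=
      (hasFDerivWithinAt_const (g z) z S).congr hS rfl
    exact hg.hasFDerivWithinAt.unique_on h0 hy
  · obtain ⟨r, rfl⟩ := hker y hy
    have h1 := hγ.hasFDerivAt.hasFDerivWithinAt (s := univ)
    have h2 := h1.mapsTo_tangent_cone
      (show r ∈ tangentConeAt ℝ univ (0 : ℝ) by rw [tangentConeAt_univ]; exact mem_univ r)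
    rw [hγ0] at h2
    have h3 := tangentConeAt_mono (𝕜 := ℝ) (x := z)
      (show γ '' univ ⊆ S by rintro _ ⟨t, -, rfl⟩; exact hγS t) h2
    simpa using h3

lemma eq_smul_of_inner_eq_zero {z y : ℂ} (hz : ‖z‖ = 1) (h : inner ℝ z y = 0) :
    y = (conj z * y).im • (Complex.I * z) := by
  rw [Complex.inner] at h
  have h1 : conj z * y = (conj z * y).im * Complex.I := by
    simp only [Complex.mul_re, Complex.conj_re, Complex.conj_im] at h
    apply Complex.ext
    · simp; linarith
    · simp
  rw [Complex.real_smul]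
  linear_combination z * h1 - y * mul_conj_of_norm_eq_one hz

lemma two_smul_innerSL_eq_zero_iff {z y : ℂ} : (2 • innerSL ℝ z) y = 0 ↔ inner ℝ z y = 0 := by
  rw [_root_.smul_apply, smul_eq_zero_iff_right two_ne_zero]
  rfl

lemma tangentConeAt_sphere {z : ℂ} (hz : ‖z‖ = 1) :
    tangentConeAt ℝ (Metric.sphere (0 : ℂ) 1) z = {y | inner ℝ z y = 0} := by
  have hg : HasFDerivAt (fun y : ℂ => ‖y‖ ^ 2) (2 • innerSL ℝ z) z :=
    (hasStrictFDerivAt_norm_sq z).hasFDerivAt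
  have hγ : HasDerivAt (fun t : ℝ => Complex.exp (t * Complex.I) * z) (Complex.I * z) 0 := by
    have h1 : HasDerivAt (fun t : ℝ => (t : ℂ) * Complex.I) (1 * Complex.I) 0 :=
      (HasDerivAt.ofReal_comp (hasDerivAt_id (0 : ℝ))).mul_const _
    simpa using (h1.cexp.mul_const z)
  rw [tangentConeAt_eq_ker hg (fun y hy => by rw [mem_sphere_zero_iff_norm.1 hy, hz]) hγ (by simp)
    (fun t => by
      rw [mem_sphere_zero_iff_norm, norm_mul, Complex.norm_exp_ofReal_mul_I, hz, one_mul])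
    (fun y hy => ⟨_, eq_smul_of_inner_eq_zero hz (two_smul_innerSL_eq_zero_iff.1 hy)⟩)]
  ext y
  exact two_smul_innerSL_eq_zero_iff

lemma areTangentAt_ellipse {e z : ℂ} {κ u Y : ℝ} (he : ‖e‖ = 1) (hz : ‖z‖ = 1)
    (hzu : (z * conj e).re = u) (hκ : 0 ≤ κ) (hY : 0 < Y)
    (hY2 : Y ^ 2 = 1 + κ * (1 - u ^ 2)) :
    AreTangentAt (ellipse e (Complex.I * e) (Y / (1 + κ)) (Y / √(1 + κ)) (κ * u / (1 + κ)))
      (Metric.sphere (0 : ℂ) 1) z := by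
  have h1 : 0 < 1 + κ := by linarith
  have hmem : ∀ w, w ∈ ellipse e (Complex.I * e) (Y / (1 + κ)) (Y / √(1 + κ)) (κ * u / (1 + κ)) ↔
      ‖w‖ ^ 2 + κ * ((w * conj e).re - u) ^ 2 = 1 := by
    intro w
    rw [mem_ellipse_iff he, ellipse_equation hκ hY hY2, norm_sq_frame he, add_eq_left,
      mul_eq_zero, or_iff_left (by positivity), sub_eq_zero]
  refine ⟨?_, mem_sphere_zero_iff_norm.2 hz, ?_⟩
  · rw [hmem, hzu, hz]; ring
  rw [tangentConeAt_sphere hz]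
  -- the term `κ (x - u)²` vanishes to second order at `z`
  have hg : HasFDerivAt (fun w : ℂ => ‖w‖ ^ 2 + κ * ((w * conj e).re - u) ^ 2)
      (2 • innerSL ℝ z) z := by
    have hL : HasFDerivAt (fun w : ℂ => (w * conj e).re - u)
        (Complex.reCLM.comp ((ContinuousLinearMap.mul ℝ ℂ).flip (conj e))) z :=
      (Complex.reCLM.comp ((ContinuousLinearMap.mul ℝ ℂ).flip (conj e))).hasFDerivAt.sub_const u
    have h2 := (hasStrictFDerivAt_norm_sq z).hasFDerivAt.add ((hL.pow 2).const_mul κ)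
    refine h2.congr_fderiv ?_
    simp [hzu]
  set y₀ := (z * conj e).im with hy₀
  have hz2 : u ^ 2 + y₀ ^ 2 = 1 := by
    have := norm_sq_frame he z
    rw [hz, hzu] at this
    linarith
  have s0 : 0 < √(1 + κ) := Real.sqrt_pos.2 h1
  have s2 : √(1 + κ) ^ 2 = 1 + κ := Real.sq_sqrt h1.le
  set q := √(1 + κ) with hq
  -- the affine image of a rotation of the circle that parametrizes the ellipse from `z` on
  let X : ℝ → ℝ := fun t => κ * u / (1 + κ) + u / (1 + κ) * Real.cos t - y₀ / q * Real.sin t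
  let Z : ℝ → ℝ := fun t => y₀ * Real.cos t + u / q * Real.sin t
  have hX : HasDerivAt X (-(y₀ / q)) 0 := by
    have := (((Real.hasDerivAt_cos 0).const_mul (u / (1 + κ))).const_add (κ * u / (1 + κ))).sub
      ((Real.hasDerivAt_sin 0).const_mul (y₀ / q))
    exact this.congr_deriv (by simp)
  have hZ : HasDerivAt Z (u / q) 0 := by
    have := ((Real.hasDerivAt_cos 0).const_mul y₀).add ((Real.hasDerivAt_sin 0).const_mul (u / q))
    exact this.congr_deriv (by simp)
  have hzf : z = u • e + y₀ • (Complex.I * e) := (eq_frame_iff he).2 ⟨hzu, rfl⟩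
  have hγ : HasDerivAt (fun t => X t • e + Z t • (Complex.I * e)) (q⁻¹ • (Complex.I * z)) 0 := by
    have := (hX.smul_const e).add (hZ.smul_const (Complex.I * e))
    refine this.congr_deriv ?_
    rw [hzf]
    simp only [Complex.real_smul]
    push_cast
    have hqc : (q : ℂ) ≠ 0 := mod_cast s0.ne'
    field_simp
    linear_combination (-(y₀ : ℂ) * e) * Complex.I_sq
  have hγ0 : X 0 • e + Z 0 • (Complex.I * e) = z := by
    have hX0 : X 0 = u := by
      simp only [X, Real.cos_zero, Real.sin_zero]
      field_simp
      ring
    have hZ0 : Z 0 = y₀ := by simp [Z]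
    rw [hX0, hZ0, ← hzf]
  have hγS : ∀ t, X t • e + Z t • (Complex.I * e) ∈
      ellipse e (Complex.I * e) (Y / (1 + κ)) (Y / q) (κ * u / (1 + κ)) := by
    intro t
    obtain ⟨e1, e2⟩ := (eq_frame_iff he).1 (rfl : X t • e + Z t • (Complex.I * e) = _)
    rw [hmem, norm_sq_frame he, e1, e2]
    simp only [X, Z]
    rw [← s2, show κ = q ^ 2 - 1 by linarith]
    field_simp
    linear_combination q ^ 2 * (u ^ 2 + y₀ ^ 2 * q ^ 2) * Real.sin_sq_add_cos_sq t + q ^ 4 * hz2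
  have hker : ∀ y, (2 • innerSL ℝ z) y = 0 → ∃ r : ℝ, y = r • (q⁻¹ • (Complex.I * z)) := by
    intro y hy
    refine ⟨q * (conj z * y).im, ?_⟩
    rw [smul_smul, mul_comm q, mul_assoc, mul_inv_cancel₀ s0.ne', mul_one]
    exact eq_smul_of_inner_eq_zero hz (two_smul_innerSL_eq_zero_iff.1 hy)
  rw [tangentConeAt_eq_ker hg (fun y hy => by rw [(hmem y).1 hy, hzu, hz]; ring) hγ hγ0 hγS hker]
  ext y
  exact two_smul_innerSL_eq_zero_iff

/-! ### The frame adapted to the line `PQ` -/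

lemma circlePt_quarter : circlePt ((1 / 4 : ℝ) : UnitAddCircle) = Complex.I := by
  rw [circlePt_coe, show (2 * Real.pi * ((1 / 4 : ℝ) : ℂ) * Complex.I : ℂ) =
    Real.pi / 2 * Complex.I by push_cast; ring, Complex.exp_pi_div_two_mul_I]

/-- The point `T₃` bisects the arc from `T₂` to `T₁`. -/
lemma exists_half_arc {T₁ T₂ T₃ : UnitAddCircle}
    (hT₁₂ : ∃ s ∈ Ioc (0 : ℝ) (1 / 2), T₁ - T₂ = (s : UnitAddCircle))
    (hT₃ : T₁ + T₂ = 2 • T₃)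
    (hT₃₂ : ∃ s ∈ Ioc (0 : ℝ) (1 / 2), T₃ - T₂ = (s : UnitAddCircle)) :
    ∃ s : ℝ, 0 < s ∧ s ≤ 1 / 4 ∧ T₁ = T₃ + (s : UnitAddCircle) ∧
      T₂ = T₃ - (s : UnitAddCircle) := by
  obtain ⟨s, ⟨s0, s1⟩, hs⟩ := hT₁₂
  obtain ⟨r, ⟨r0, r1⟩, hr⟩ := hT₃₂
  have h : ((2 * r - s : ℝ) : UnitAddCircle) = 0 := by
    rw [AddCircle.coe_sub, two_mul, AddCircle.coe_add, ← hr, ← hs,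
      show T₃ - T₂ + (T₃ - T₂) - (T₁ - T₂) = 2 • T₃ - (T₁ + T₂) by abel, hT₃, sub_self]
  obtain ⟨n, hn⟩ := (AddCircle.coe_eq_zero_iff 1).1 h
  have hn : (n : ℝ) = 2 * r - s := by rw [← hn]; simp
  have n1 : (-1 : ℝ) < n := by linarith
  have n2 : (n : ℝ) < 1 := by linarith
  have n1' : -1 < n := mod_cast n1
  have n2' : n < 1 := mod_cast n2
  have n0 : n = 0 := by omega
  rw [n0, Int.cast_zero] at hn
  refine ⟨r, r0, by linarith, ?_, ?_⟩
  · rw [← hr, show T₃ + (T₃ - T₂) = 2 • T₃ - T₂ by abel, ← hT₃]; abel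
  · rw [← hr]; abel

/-- In the frame with first vector `T₃` the endpoints `T₁`, `T₂` are conjugate. -/
lemma exists_frame_coords {T₁ T₂ T₃ : UnitAddCircle}
    (hT₁₂ : ∃ s ∈ Ioc (0 : ℝ) (1 / 2), T₁ - T₂ = (s : UnitAddCircle))
    (hT₃ : T₁ + T₂ = 2 • T₃)
    (hT₃₂ : ∃ s ∈ Ioc (0 : ℝ) (1 / 2), T₃ - T₂ = (s : UnitAddCircle)) :
    ∃ w : ℂ, ‖w‖ = 1 ∧ 0 < w.im ∧ circlePt T₁ * conj (circlePt T₃) = w ∧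
      circlePt T₂ * conj (circlePt T₃) = conj w := by
  obtain ⟨s, s0, s1, h1, h2⟩ := exists_half_arc hT₁₂ hT₃ hT₃₂
  have e3 := mul_conj_of_norm_eq_one (norm_circlePt T₃)
  have hneg : circlePt (-(s : UnitAddCircle)) = conj (circlePt (s : UnitAddCircle)) := by
    rw [circlePt, AddCircle.toCircle_neg, Circle.coe_inv_eq_conj]; rfl
  refine ⟨circlePt (s : UnitAddCircle), norm_circlePt _, ?_, ?_, ?_⟩
  · rw [circlePt_coe, show (2 * Real.pi * s * Complex.I : ℂ) =
      ((Real.pi * (2 * s) : ℝ) : ℂ) * Complex.I by push_cast; ring, Complex.exp_ofReal_mul_I_im]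
    exact sin_pi_mul_pos (by linarith) (by linarith)
  · rw [h1, circlePt_add]
    linear_combination circlePt (s : UnitAddCircle) * e3
  · rw [h2, sub_eq_add_neg, circlePt_add, hneg]
    linear_combination conj (circlePt (s : UnitAddCircle)) * e3

/-- In the frame of `e` the line `PQ` is vertical, because it contains two conjugate points. -/
lemma re_eq_of_mem_line {P Q T₁ T₂ e w : ℂ} (hT₁ : T₁ ∈ line[ℝ, P, Q]) (hT₂ : T₂ ∈ line[ℝ, P, Q])
    (h1 : T₁ * conj e = w) (h2 : T₂ * conj e = conj w) (hw : 0 < w.im) :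
    (P * conj e).re = w.re ∧ (Q * conj e).re = w.re := by
  obtain ⟨r, hr⟩ := mem_affineSpan_pair_iff_exists_lineMap_eq.1 hT₁
  obtain ⟨t, ht⟩ := mem_affineSpan_pair_iff_exists_lineMap_eq.1 hT₂
  rw [AffineMap.lineMap_apply_module] at hr ht
  have key : ∀ s : ℝ, ((1 - s) • P + s • Q) * conj e =
      ((1 - s : ℝ) : ℂ) * (P * conj e) + (s : ℂ) * (Q * conj e) := by
    intro s; simp only [Complex.real_smul]; ring
  rw [← hr, key] at h1
  rw [← ht, key] at h2
  have a1 := congrArg Complex.re h1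
  have a2 := congrArg Complex.re h2
  have b1 := congrArg Complex.im h1
  have b2 := congrArg Complex.im h2
  simp only [Complex.add_re, Complex.add_im, Complex.re_ofReal_mul, Complex.im_ofReal_mul,
    Complex.conj_re, Complex.conj_im] at a1 a2 b1 b2
  have hrt : r - t ≠ 0 := by
    intro h
    have : r = t := by linarith
    subst this
    linarith
  have hPQ : (Q * conj e).re = (P * conj e).re := by
    have : (r - t) * ((Q * conj e).re - (P * conj e).re) = 0 := by linear_combination a1 - a2
    linarith [(mul_eq_zero.1 this).resolve_left hrt]
  rw [hPQ] at a1 ⊢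
  exact ⟨by linarith, by linarith⟩

end BarBilliard

open BarBilliard ComplexConjugate in
theorem theorem3p2
    -- a nondegenerate triangle in the open unit disk
    (P Q R : ℂ) (hP : ‖P‖ < 1) (hQ : ‖Q‖ < 1) (hR : ‖R‖ < 1)
    (hPQR : AffineIndependent ℝ ![P, Q, R])
    -- the endpoints of the line `PQ` on the unit circle, and the frame adapted to them
    (T₁ T₂ T₃ T₄ : UnitAddCircle)
    (hT₁ : BarBilliard.circlePt T₁ ∈ line[ℝ, P, Q])
    (hT₂ : BarBilliard.circlePt T₂ ∈ line[ℝ, P, Q])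
    (hT₁₂ : ∃ s ∈ Set.Ioc (0 : ℝ) (1 / 2), T₁ - T₂ = (s : UnitAddCircle))
    (hT₃ : T₁ + T₂ = 2 • T₃)
    (hT₃₂ : ∃ s ∈ Set.Ioc (0 : ℝ) (1 / 2), T₃ - T₂ = (s : UnitAddCircle))
    (hT₄ : T₄ = T₃ + ((1 / 4 : ℝ) : UnitAddCircle))
    -- `u` is the first coordinate of `P` in the basis `T₃, T₄`
    (u p : ℝ) (hu : P = u • BarBilliard.circlePt T₃ + p • BarBilliard.circlePt T₄)
    (k : ℝ) (hk : k = Real.exp (BarBilliard.kleinDist P Q))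
    (A B C : ℝ)
    (hA : A = 2 * k * (k ^ 2 + 1) * (1 - u ^ 2) /
      ((k ^ 2 - 2 * k * u + 1) * (k ^ 2 + 2 * k * u + 1)))
    (hB : B = (k ^ 2 + 1) * Real.sqrt (1 - u ^ 2) /
      Real.sqrt ((k ^ 2 - 2 * k * u + 1) * (k ^ 2 + 2 * k * u + 1)))
    (hC : C = (k ^ 2 - 1) ^ 2 * u /
      ((k ^ 2 - 2 * k * u + 1) * (k ^ 2 + 2 * k * u + 1)))
    (E Φ : Set ℂ)
    (hE : E = BarBilliard.ellipse (BarBilliard.circlePt T₃) (BarBilliard.circlePt T₄) A B C)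
    (hΦ : Φ = BarBilliard.ellipseInner (BarBilliard.circlePt T₃) (BarBilliard.circlePt T₄) A B C) :
    -- the ellipse is nondegenerate
    (0 < (k ^ 2 - 2 * k * u + 1) * (k ^ 2 + 2 * k * u + 1) ∧ 0 < A ∧ 0 < B) ∧
    -- the expressions of its axes and centre in terms of `a`, whenever `a` is defined
    (u * (k ^ 2 - 1) - 2 * k * Real.sqrt (1 - u ^ 2) ≠ 0 →
      ∀ a : ℝ, a = (k ^ 2 - 1) / (u * (k ^ 2 - 1) - 2 * k * Real.sqrt (1 - u ^ 2)) →
        0 < (u ^ 2 + 1) * a ^ 2 - 2 * a * u + 1 ∧ 0 ≤ a ^ 2 - 2 * u * a + 1 ∧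
        A = |a * u - 1| * Real.sqrt (a ^ 2 - 2 * u * a + 1) /
          ((u ^ 2 + 1) * a ^ 2 - 2 * a * u + 1) ∧
        B = Real.sqrt (a ^ 2 - 2 * u * a + 1) / Real.sqrt ((u ^ 2 + 1) * a ^ 2 - 2 * a * u + 1) ∧
        C = a ^ 2 * u / ((u ^ 2 + 1) * a ^ 2 - 2 * a * u + 1)) ∧
    -- the ellipse lies in the closed disk and is tangent to the unit circle at `T₁` and `T₂`
    E ⊆ Metric.closedBall (0 : ℂ) 1 ∧
    BarBilliard.AreTangentAt E (Metric.sphere (0 : ℂ) 1) (BarBilliard.circlePt T₁) ∧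
    BarBilliard.AreTangentAt E (Metric.sphere (0 : ℂ) 1) (BarBilliard.circlePt T₂) ∧
    -- the number of inscribed circumscribing triangles
    (R ∈ Φ → (BarBilliard.circumscribingTriangles P Q R).encard = 0) ∧
    (R ∈ E → (BarBilliard.circumscribingTriangles P Q R).encard = 1) ∧
    (R ∉ closure Φ → (BarBilliard.circumscribingTriangles P Q R).encard = 2) ∧
    -- the rotation number of the bar billiard map exists, and when it is `1 / 3`
    (∃! F : CircleDeg1Lift, BarBilliard.IsLift F (BarBilliard.barMap P Q R)) ∧
    (∀ F : CircleDeg1Lift, BarBilliard.IsLift F (BarBilliard.barMap P Q R) →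
      (F.translationNumber = 1 / 3 ↔ R ∈ E ∨ R ∉ closure Φ)) := by
  have he : ‖circlePt T₃‖ = 1 := norm_circlePt T₃
  have hIe : circlePt T₄ = Complex.I * circlePt T₃ := by
    rw [hT₄, circlePt_add, circlePt_quarter, mul_comm]
  obtain ⟨w, hw1, hw0, hw₁, hw₂⟩ := exists_frame_coords hT₁₂ hT₃ hT₃₂
  obtain ⟨hPu, hQu⟩ := re_eq_of_mem_line hT₁ hT₂ hw₁ hw₂ hw0
  rw [hIe] at hu hE hΦ
  generalize circlePt T₃ = e at *
  obtain ⟨hxP, rfl⟩ := (eq_frame_iff he).1 hu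
  have hwu : w.re = u := hPu.symm.trans hxP
  rw [hwu] at hQu
  have hu1 : u ^ 2 < 1 := by
    have h1 : w.re ^ 2 + w.im ^ 2 = 1 := by
      have := Complex.sq_norm w
      rw [hw1, Complex.normSq_apply] at this
      linarith
    rw [hwu] at h1
    nlinarith
  have dP : 0 < 1 - ‖P‖ ^ 2 := by nlinarith [norm_nonneg P]
  have dQ : 0 < 1 - ‖Q‖ ^ 2 := by nlinarith [norm_nonneg Q]
  have nP := norm_sq_frame he P
  have nQ := norm_sq_frame he Q
  rw [hxP] at nP
  rw [hQu] at nQ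
  set p := (P * conj e).im
  set q := (Q * conj e).im with hq
  have hcosh := cosh_kleinDist hP hQ
  rw [re_mul_re_add_frame he, hxP, hQu, ← hq] at hcosh
  set Y := Real.cosh (kleinDist P Q) with hYdef
  have hY : 0 < Y := Real.cosh_pos _
  have hk0 : 0 < k := hk ▸ Real.exp_pos _
  have hkY : k ^ 2 + 1 = 2 * k * Y := by
    rw [hYdef, Real.cosh_eq, Real.exp_neg, ← hk]
    field_simp
  -- the coefficient of the conic is `sinh² d'(P, Q) / (1 - u²)`
  obtain ⟨κ, hκ⟩ : ∃ κ, κ = (p - q) ^ 2 / ((1 - ‖P‖ ^ 2) * (1 - ‖Q‖ ^ 2)) := ⟨_, rfl⟩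
  have hκ0 : 0 ≤ κ := by rw [hκ]; positivity
  have hκ' : κ * ((1 - ‖P‖ ^ 2) * (1 - ‖Q‖ ^ 2)) = (p - q) ^ 2 := by
    rw [hκ, div_mul_cancel₀ _ (by positivity)]
  have hY2 : Y ^ 2 = 1 + κ * (1 - u ^ 2) := by
    have h1 : Y ^ 2 * ((1 - ‖P‖ ^ 2) * (1 - ‖Q‖ ^ 2)) = (1 - (u * u + p * q)) ^ 2 := by
      rw [← hcosh, mul_pow, mul_pow, Real.sq_sqrt dP.le, Real.sq_sqrt dQ.le]
    have h2 : (Y ^ 2 - (1 + κ * (1 - u ^ 2))) * ((1 - ‖P‖ ^ 2) * (1 - ‖Q‖ ^ 2)) = 0 := by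
      have h3 : (1 - ‖P‖ ^ 2) * (1 - ‖Q‖ ^ 2) = (1 - u ^ 2 - p ^ 2) * (1 - u ^ 2 - q ^ 2) := by
        rw [nP, nQ]; ring
      linear_combination h1 - (1 - u ^ 2) * hκ' - h3
    have := (mul_eq_zero.1 h2).resolve_right (by positivity)
    linarith
  obtain ⟨hN, hAY, hBY, hCY⟩ := ellipse_axes hκ0 hu1 hk0 hkY hY hY2
  have h1κ : 0 < 1 + κ := by linarith
  have hEeq : E = ellipse e (Complex.I * e) (Y / (1 + κ)) (Y / √(1 + κ)) (κ * u / (1 + κ)) := by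
    rw [hE, hA, hB, hC, hAY, hBY, hCY]
  have hΦeq : Φ = ellipseInner e (Complex.I * e) (Y / (1 + κ)) (Y / √(1 + κ))
      (κ * u / (1 + κ)) := by
    rw [hΦ, hA, hB, hC, hAY, hBY, hCY]
  have hc : 0 < (1 + κ) / Y ^ 2 := by positivity
  -- the equation of the conic at `R` compares the two sides of the fixed point criterion
  have hcmp : (‖R‖ ^ 2 + κ * ((R * conj e).re - u) ^ 2 - 1) * ((1 - ‖P‖ ^ 2) * (1 - ‖Q‖ ^ 2)) =
      (turnA P Q R).im ^ 2 - (1 - ‖P‖ ^ 2) * (1 - ‖Q‖ ^ 2) * (1 - ‖R‖ ^ 2) := by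
    rw [turnA_im_frame he (hQu.trans hxP.symm), hxP]
    linear_combination ((R * conj e).re - u) ^ 2 * hκ'
  have dPQ : 0 < (1 - ‖P‖ ^ 2) * (1 - ‖Q‖ ^ 2) := mul_pos dP dQ
  have hRE : R ∈ E ↔
      (turnA P Q R).im ^ 2 = (1 - ‖P‖ ^ 2) * (1 - ‖Q‖ ^ 2) * (1 - ‖R‖ ^ 2) := by
    rw [hEeq, mem_ellipse_iff he, ellipse_equation hκ0 hY hY2, ← norm_sq_frame he, add_eq_left,
      mul_eq_zero, or_iff_left hc.ne', ← sub_eq_zero (a := (turnA P Q R).im ^ 2), ← hcmp,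
      mul_eq_zero, or_iff_left dPQ.ne']
  have hneg : ∀ {a b : ℝ}, 0 < b → (a * b < 0 ↔ a < 0) := fun hb =>
    ⟨fun h => neg_of_mul_neg_left h hb.le, fun h => mul_neg_of_neg_of_pos h hb⟩
  have hRΦ : R ∈ Φ ↔
      (turnA P Q R).im ^ 2 < (1 - ‖P‖ ^ 2) * (1 - ‖Q‖ ^ 2) * (1 - ‖R‖ ^ 2) := by
    rw [hΦeq, mem_ellipseInner_iff he, ellipse_equation hκ0 hY hY2, ← norm_sq_frame he,
      add_lt_iff_neg_left, hneg hc, ← sub_neg (a := (turnA P Q R).im ^ 2),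
      ← hcmp, hneg dPQ]
  have hRcl : R ∉ closure Φ ↔
      (1 - ‖P‖ ^ 2) * (1 - ‖Q‖ ^ 2) * (1 - ‖R‖ ^ 2) < (turnA P Q R).im ^ 2 := by
    rw [hΦeq, mem_closure_ellipseInner_iff he, ellipse_equation hκ0 hY hY2, ← norm_sq_frame he,
      not_le, lt_add_iff_pos_right, mul_pos_iff_of_pos_right hc,
      ← sub_pos (a := (turnA P Q R).im ^ 2), ← hcmp, mul_pos_iff_of_pos_right dPQ]
  refine ⟨⟨hN, ?_, ?_⟩, ?_, ?_, ?_, ?_, ?_, ?_, ?_, ?_, ?_⟩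
  · rw [hA, hAY]; positivity
  · rw [hB, hBY]; positivity
  · intro hd a ha
    rw [hA, hB, hC]
    exact ellipse_axes_eq_of_parameter hk0 hu1 rfl hd ha hN
  · intro z hz
    rw [hEeq, mem_ellipse_iff he, ellipse_equation hκ0 hY hY2, ← norm_sq_frame he, add_eq_left,
      mul_eq_zero, or_iff_left hc.ne'] at hz
    have h1 : 0 ≤ κ * ((z * conj e).re - u) ^ 2 := by positivity
    have h2 : ‖z‖ ^ 2 ≤ 1 := by linarith
    rw [mem_closedBall_zero_iff]
    exact (sq_le_one_iff₀ (norm_nonneg z)).1 h2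
  · rw [hEeq]
    exact areTangentAt_ellipse he (norm_circlePt T₁) (by rw [hw₁, hwu]) hκ0 hY hY2
  · rw [hEeq]
    exact areTangentAt_ellipse he (norm_circlePt T₂) (by rw [hw₂, Complex.conj_re, hwu]) hκ0 hY hY2
  · exact fun h => encard_circumscribingTriangles_eq_zero hP hQ hR (hRΦ.1 h)
  · exact fun h => encard_circumscribingTriangles_eq_one hP hQ hR (hRE.1 h)
  · exact fun h => encard_circumscribingTriangles_eq_two hP hQ hR (hRcl.1 h)
  · exact ⟨barLift hP hQ hR, isLift_barLift hP hQ hR,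
      fun F hF => hF.unique (isLift_barLift hP hQ hR)⟩
  · intro F hF
    rw [hF.unique (isLift_barLift hP hQ hR), translationNumber_barLift_eq_iff, hRE, hRcl, or_comm,
      le_iff_lt_or_eq, eq_comm (a := (turnA P Q R).im ^ 2)]
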